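/- **Proposition 4.6.** All spaces are over $\mathbb C$. Let $p=0$ or $1\le p<\infty$, and let $(G_n)_{n\ge1}$ be a sequence of finite-dimensional Banach spaces such that for each $i$ the set $\{n : G_n\cong G_i \text{ isometrically}\}$ is infinite. Let $J=(\bigoplus_{n=1}^\infty G_n)_p$ be the corresponding Johnson space, that is, the $\ell_p$-sum of the $G_n$ (the $c_0$-sum, if $p=0$). Let $X$ be a $J$-space, that is, a Banach space for which there is $\lambda\ge1$ such that every finite-dimensional subspace $E$ of $X$ is contained in a subspace $G$ of $X$ whose Banach–Mazur distance to some $G_i$ satisfies $d(G,G_i)\le\lambda$. For Banach spaces $Y,Z$ let $\mathcal A(Y,Z)$ be the space of approximable operators $Y\to Z$, the operator-norm closure of the bounded finite rank operators, and let $\mathcal A(Y)=\mathcal A(Y,Y)$. Then 1. $\mathcal A(J)$ is weakly amenable: every bounded derivation $D\colon\mathcal A(J)\to\mathcal A(J)^*$ is inner; 2. $\mathcal A(X)$ factors approximately through $\mathcal A(J)$: multiplication $U\otimes V\mapsto UV$ implements an isomorphism of Banach spaces $$\mathcal A(J,X)\,\widehat\otimes_{\mathcal A(J)}\,\mathcal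 A(X,J)\;\cong\;\mathcal A(X),$$ where $P\,\widehat\otimes_{\mathfrak A}\,Q$ denotes the quotient of the projective tensor product $P\,\widehat\otimes\,Q$ by the closed linear span of all $x.a\otimes y-x\otimes a.y$ with $x\in P$, $y\in Q$, $a\in\mathfrak A$. -/

import Mathlib

open scoped ENNReal TensorProduct
open Filter Topology

noncomputable section

namespace BanachOp

/-! ### The projective tensor product of Banach spaces -/

section Projective

set_option linter.unusedSectionVars false

variable (E F : Type*) [NormedAddCommGroup E] [NormedSpace ℂ E]
  [NormedAddCommGroup F] [NormedSpace ℂ F]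

/-- The algebraic tensor product `E ⊗ F`, as a separate type which will carry the projective
norm. -/
def AlgTensor : Type _ := E ⊗[ℂ] F

instance : AddCommGroup (AlgTensor E F) := inferInstanceAs (AddCommGroup (E ⊗[ℂ] F))
instance : Module ℂ (AlgTensor E F) := inferInstanceAs (Module ℂ (E ⊗[ℂ] F))

variable {E F}

/-- The elementary tensor `x ⊗ y` in the algebraic tensor product. -/
def AlgTensor.tmul (x : E) (y : F) : AlgTensor E F := x ⊗ₜ[ℂ] y

/-- A finite list of pairs `(xᵢ, yᵢ)` represents `t` if `t = ∑ xᵢ ⊗ yᵢ`. -/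
def AlgTensor.Represents (l : List (E × F)) (t : AlgTensor E F) : Prop :=
  (l.map fun q => AlgTensor.tmul q.1 q.2).sum = t

/-- The cost `∑ ‖xᵢ‖ ‖yᵢ‖` of a representation. -/
def AlgTensor.cost (l : List (E × F)) : ℝ := (l.map fun q => ‖q.1‖ * ‖q.2‖).sum

/-- The projective norm `‖t‖ = inf {∑ ‖xᵢ‖ ‖yᵢ‖ : t = ∑ xᵢ ⊗ yᵢ}`. -/
def AlgTensor.projNorm (t : AlgTensor E F) : ℝ :=
  ⨅ l : {l : List (E × F) // AlgTensor.Represents l t}, AlgTensor.cost l.1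

namespace AlgTensor

theorem cost_nonneg (l : List (E × F)) : 0 ≤ cost l := by
  refine List.sum_nonneg fun a ha => ?_
  obtain ⟨q, -, rfl⟩ := List.mem_map.1 ha
  positivity

theorem exists_represents (t : AlgTensor E F) : ∃ l : List (E × F), Represents l t := by
  refine TensorProduct.induction_on (motive := fun t => ∃ l : List (E × F), Represents l t) t
    ⟨[], rfl⟩ (fun x y => ⟨[(x, y)], ?_⟩) ?_
  · exact add_zero (tmul x y)
  · rintro a b ⟨l, hl⟩ ⟨m, hm⟩
    refine ⟨l ++ m, ?_⟩
    change ((l ++ m).map fun q => tmul q.1 q.2).sum = _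
    rw [List.map_append, List.sum_append]
    exact congrArg₂ (fun a b : AlgTensor E F => a + b) hl hm

instance (t : AlgTensor E F) : Nonempty {l : List (E × F) // Represents l t} :=
  let ⟨l, hl⟩ := exists_represents t
  ⟨⟨l, hl⟩⟩

theorem projNorm_le {t : AlgTensor E F} {l : List (E × F)} (h : Represents l t) :
    projNorm t ≤ cost l :=
  ciInf_le (f := fun l : {l : List (E × F) // Represents l t} => cost l.1)
    ⟨0, by rintro _ ⟨m, rfl⟩; exact cost_nonneg _⟩ ⟨l, h⟩

theorem projNorm_zero : projNorm (0 : AlgTensor E F) = 0 :=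
  le_antisymm (projNorm_le (l := []) rfl) (le_ciInf fun l => cost_nonneg l.1)

theorem projNorm_add_le (s t : AlgTensor E F) :
    projNorm (s + t) ≤ projNorm s + projNorm t := by
  refine le_ciInf_add_ciInf fun l m => ?_
  have h : Represents (l.1 ++ m.1) (s + t) := by
    rw [Represents, List.map_append, List.sum_append]
    exact congrArg₂ _ l.2 m.2
  refine (projNorm_le h).trans_eq ?_
  simp [cost]

theorem projNorm_smul_le (c : ℂ) (t : AlgTensor E F) :
    projNorm (c • t) ≤ ‖c‖ * projNorm t := by
  rw [projNorm, projNorm, Real.mul_iInf_of_nonneg (norm_nonneg c)]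
  refine le_ciInf fun l => ?_
  have h : Represents (l.1.map fun q => (c • q.1, q.2)) (c • t) := by
    have hl : c • (l.1.map fun q => tmul q.1 q.2).sum = c • t := congrArg (c • ·) l.2
    rw [Represents, List.map_map, ← hl, List.smul_sum, List.map_map]
    rfl
  refine (projNorm_le h).trans_eq ?_
  simp [cost, Function.comp_def, norm_smul, mul_assoc, List.sum_map_mul_left]

/-- The projective norm as a seminorm. -/
def projSeminorm : Seminorm ℂ (AlgTensor E F) :=
  Seminorm.ofSMulLE projNorm projNorm_zero projNorm_add_le projNorm_smul_le

instance : SeminormedAddCommGroup (AlgTensor E F) :=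
  (projSeminorm (E := E) (F := F)).toAddGroupSeminorm.toSeminormedAddCommGroup

instance : NormedSpace ℂ (AlgTensor E F) := ⟨projNorm_smul_le⟩

end AlgTensor

variable (E F)

/-- The projective tensor product of `E` and `F`: the completion of the algebraic tensor product
for the projective norm. -/
abbrev ProjTensor : Type _ := UniformSpace.Completion (AlgTensor E F)

variable {E F}

/-- The elementary tensor `x ⊗ y` in the projective tensor product. -/
def ProjTensor.tmul (x : E) (y : F) : ProjTensor E F :=
  ((AlgTensor.tmul x y : AlgTensor E F) : UniformSpace.Completion (AlgTensor E F))

/-- For a right action `ρ` of `A` on `E` and a left action `σ` of `A` on `F`, the closed linear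
span of all `(x · a) ⊗ y - x ⊗ (a · y)`. -/
def balancedRelations {A : Type*} (ρ : E → A → E) (σ : A → F → F) :
    Submodule ℂ (ProjTensor E F) :=
  (Submodule.span ℂ {z | ∃ (x : E) (a : A) (y : F),
    z = ProjTensor.tmul (ρ x a) y - ProjTensor.tmul x (σ a y)}).topologicalClosure

/-- The tensor product `E ⊗̂_A F` of a right and a left Banach `A`-module: the quotient of the
projective tensor product by the closed span of the balancing relations. -/
abbrev BalancedTensor {A : Type*} (ρ : E → A → E) (σ : A → F → F) : Type _ :=
  ProjTensor E F ⧸ balancedRelations ρ σ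

end Projective

/-! ### Approximable operators -/

section Approximable

variable (X Y : Type*) [NormedAddCommGroup X] [NormedSpace ℂ X]
  [NormedAddCommGroup Y] [NormedSpace ℂ Y]

/-- The bounded operators `X → Y` of finite rank. -/
def finiteRank : Submodule ℂ (X →L[ℂ] Y) where
  carrier := {T | FiniteDimensional ℂ (LinearMap.range (T : X →ₗ[ℂ] Y))}
  zero_mem' := by
    change FiniteDimensional ℂ (LinearMap.range (0 : X →ₗ[ℂ] Y))
    rw [LinearMap.range_zero]
    infer_instance
  add_mem' := by
    intro S T hS hT
    simp only [Set.mem_ofPred_eq] at hS hT ⊢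
    exact Submodule.finiteDimensional_of_le
      (LinearMap.range_add_le (S : X →ₗ[ℂ] Y) (T : X →ₗ[ℂ] Y))
  smul_mem' := by
    intro c T hT
    simp only [Set.mem_ofPred_eq] at hT ⊢
    refine Submodule.finiteDimensional_of_le
      (S₂ := LinearMap.range (T : X →ₗ[ℂ] Y)) ?_
    rintro _ ⟨x, rfl⟩
    exact ⟨c • x, by simp⟩

/-- The space `𝒜(X, Y)` of approximable operators: the closure of the finite rank operators in the
operator norm. -/
def approximable : Submodule ℂ (X →L[ℂ] Y) := (finiteRank X Y).topologicalClosure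

variable {X Y}

theorem comp_mem_approximable {Z : Type*} [NormedAddCommGroup Z] [NormedSpace ℂ Z]
    (S : Y →L[ℂ] Z) {T : X →L[ℂ] Y} (hT : T ∈ approximable X Y) :
    S.comp T ∈ approximable X Z := by
  refine map_mem_closure (s := (finiteRank X Y : Set (X →L[ℂ] Y)))
    (t := (finiteRank X Z : Set (X →L[ℂ] Z))) (f := fun T : X →L[ℂ] Y => S.comp T)
    (by fun_prop) hT ?_
  intro T hT
  have hT' : FiniteDimensional ℂ (LinearMap.range (T : X →ₗ[ℂ] Y)) := hT
  change FiniteDimensional ℂ (LinearMap.range ((S : Y →ₗ[ℂ] Z) ∘ₗ (T : X →ₗ[ℂ] Y)))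
  rw [LinearMap.range_comp]
  infer_instance

/-- Composition `𝒜(Y, Z) × 𝒜(X, Y) → 𝒜(X, Z)`. -/
def approximableComp {Z : Type*} [NormedAddCommGroup Z] [NormedSpace ℂ Z]
    (S : approximable Y Z) (T : approximable X Y) : approximable X Z :=
  ⟨S.1.comp T.1, comp_mem_approximable S.1 T.2⟩

variable (X Y)

/-- The Banach algebra `𝒜(X) = 𝒜(X, X)`, with composition as product and the operator norm. -/
def approximableAlgebra : NonUnitalSubalgebra ℂ (X →L[ℂ] X) where
  toNonUnitalSubsemiring :=
    { (approximable X X).toAddSubmonoid with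
      mul_mem' := fun {S _} _ hT => comp_mem_approximable S hT }
  smul_mem' := fun c _ hT => (approximable X X).smul_mem c hT

instance : NormedSpace ℂ (approximableAlgebra X) where
  norm_smul_le c T := norm_smul_le c (T : X →L[ℂ] X)

/-- `𝒜(X)` factors approximately through `Y`: composition of operators
`U ⊗ V ↦ U ∘ V` implements an isomorphism of Banach spaces
`𝒜(Y, X) ⊗̂_{𝒜(Y)} 𝒜(X, Y) ≅ 𝒜(X)`. -/
def FactorsApproximately : Prop :=
  ∃ e : BalancedTensor
      (fun (U : approximable Y X) (S : approximable Y Y) => approximableComp U S)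
      (fun (S : approximable Y Y) (V : approximable X Y) => approximableComp S V)
      ≃L[ℂ] approximable X X,
    ∀ (U : approximable Y X) (V : approximable X Y),
      e (Submodule.Quotient.mk (ProjTensor.tmul U V)) = approximableComp U V

end Approximable

/-! ### Weak amenability -/

section WeakAmenability

variable (A : Type*) [NonUnitalNormedRing A] [NormedSpace ℂ A]

/-- The Banach algebra `A` is weakly amenable: every bounded derivation `D : A → A*` is inner.
The dual `A*` has the module actions `(a · f) c = f (c a)` and `(f · a) c = f (a c)`, so that
`D (a b) = a · D b + D a · b`, and `D` is inner if `D a = a · f - f · a` for some `f` in `A*`. -/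
def WeaklyAmenable : Prop :=
  ∀ D : A →L[ℂ] StrongDual ℂ A,
    (∀ a b c : A, D (a * b) c = D b (c * a) + D a (b * c)) →
      ∃ f : StrongDual ℂ A, ∀ a c : A, D a c = f (c * a) - f (a * c)

end WeakAmenability

/-! ### Johnson spaces -/

/-- The Banach-Mazur distance `inf ‖T‖ ‖T⁻¹‖` over all isomorphisms `T : E → F`; it is `∞` if
`E` and `F` are not isomorphic. -/
def banachMazurDist (E F : Type*) [NormedAddCommGroup E] [NormedSpace ℂ E]
    [NormedAddCommGroup F] [NormedSpace ℂ F] : ℝ≥0∞ :=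
  ⨅ T : E ≃L[ℂ] F,
    ENNReal.ofReal (‖(T : E →L[ℂ] F)‖ * ‖(T.symm : F →L[ℂ] E)‖)

section Johnson

variable (G : ℕ → Type*) [∀ n, NormedAddCommGroup (G n)] [∀ n, NormedSpace ℂ (G n)]

/-- The `c₀`-sum of the spaces `G n`: sequences with `‖x n‖ → 0`, with the supremum norm. -/
def c0Sum : Submodule ℂ (lp G ∞) where
  carrier := {x | Tendsto (fun n => ‖x n‖) atTop (𝓝 0)}
  zero_mem' := by simp
  add_mem' := by
    intro x y hx hy
    refine squeeze_zero (fun n => norm_nonneg _) (fun n => ?_) (by simpa using hx.add hy)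
    exact norm_add_le (x n) (y n)
  smul_mem' := by
    intro c x hx
    simpa [norm_smul] using hx.const_mul ‖c‖

/-- `J` is the Johnson space `(⊕ G n)_p`, with `p = 0` or `1 ≤ p < ∞`: the spaces `G n` are
finite-dimensional, each of them occurs, up to isometric isomorphism, infinitely often in the
sequence, and `J` is (isometrically) their `ℓ_p`-sum or their `c₀`-sum. -/
structure IsJohnsonSpace (J : Type*) [NormedAddCommGroup J] [NormedSpace ℂ J] : Prop where
  finiteDimensional : ∀ n, FiniteDimensional ℂ (G n)
  infinite_isometric : ∀ i, {n | Nonempty (G n ≃ₗᵢ[ℂ] G i)}.Infinite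
  isSum : Nonempty (J ≃ₗᵢ[ℂ] c0Sum G) ∨
    ∃ (p : ℝ≥0∞) (_ : Fact (1 ≤ p)), p ≠ ∞ ∧ Nonempty (J ≃ₗᵢ[ℂ] lp G p)

/-- `X` is a `J`-space for the Johnson space `J = (⊕ G n)_p`. -/
def IsJSpace (X : Type*) [NormedAddCommGroup X] [NormedSpace ℂ X] : Prop :=
  ∃ C : ℝ, 1 ≤ C ∧ ∀ E : Submodule ℂ X, FiniteDimensional ℂ E →
    ∃ H : Submodule ℂ X, E ≤ H ∧ ∃ i, banachMazurDist H (G i) ≤ ENNReal.ofReal C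

end Johnson

end BanachOp

end

/-! Weak amenability. Since every block recurs infinitely often, the first `N` blocks have `N + 1`
disjoint isometric copies in `J`. The partial isometries between the copies are matrix units in
`𝒜(J)` whose `(0, 0)` corner is the band projection `P N`. The norm of `J` only sees the norms of
disjoint pieces, so signed permutation matrices are contractive (`exists_matrixUnits`). A derivation
`D` is corrected by inner derivations, at a cost proportional to `‖D‖`, until it vanishes on the
matrix units (`exists_apply_idempotent_eq`, `exists_apply_matrixUnits_eq`). It then commutes with
them, and repeating `a` and `c` along the diagonal multiplies `D a c` by `N + 1` without increasing
the norms of `a` and `c`. So the corrected derivation is of order `1 / N` on the corner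
(`card_mul_norm_apply_le`). As `P N` is a left approximate identity, a weak* limit point of the
correcting functionals implements `D`.

Factorization. If `U` has finite rank and `W ∘ α` is the identity on the range of `U`, then `U = W ∘
(α ∘ U)` with `α ∘ U` in `𝒜(J)`. Balancing gives `U ⊗ V = W ⊗ (α ∘ U ∘ V)`, with one pair `W, α`
serving a whole finite sum of tensors. A dense set of tensors `z` is thus recovered from the
products `m z`, and if `W, α` have uniform bounds then `‖z‖ ≤ K ‖m z‖` (`norm_le_mul`). In a
`J`-space such `W, α` exist: a finite-dimensional subspace lies in a uniform copy of some block of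
`J` (`exists_factorsLocally`). -/

noncomputable section

namespace BanachOp

/-! ### Derivations into the dual and contractive matrix units. -/

section Derivations

set_option linter.unusedSectionVars false

variable {A : Type*} [NonUnitalNormedRing A] [NormedSpace ℂ A]
  [IsScalarTower ℂ A A] [SMulCommClass ℂ A A]

/-- Derivations `A → A*`, in the form used in the definition of weak amenability. -/
def IsDualDerivation (D : A →L[ℂ] StrongDual ℂ A) : Prop :=
  ∀ a b c : A, D (a * b) c = D b (c * a) + D a (b * c)

/-- The inner derivation `a ↦ a · f - f · a`. -/
def innerDerivation (f : StrongDual ℂ A) : A →L[ℂ] StrongDual ℂ A :=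
  (ContinuousLinearMap.compL ℂ A A ℂ f).comp
    ((ContinuousLinearMap.mul ℂ A).flip - ContinuousLinearMap.mul ℂ A)

@[simp]
theorem innerDerivation_apply (f : StrongDual ℂ A) (a c : A) :
    innerDerivation f a c = f (c * a) - f (a * c) := by
  simp [innerDerivation]

theorem norm_innerDerivation_le (f : StrongDual ℂ A) : ‖innerDerivation f‖ ≤ 2 * ‖f‖ := by
  refine ContinuousLinearMap.opNorm_le_bound₂ _ (by positivity) fun a c => ?_
  have h₁ : ‖f (c * a)‖ ≤ ‖f‖ * (‖c‖ * ‖a‖) :=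
    (f.le_opNorm _).trans (by gcongr; exact norm_mul_le _ _)
  have h₂ : ‖f (a * c)‖ ≤ ‖f‖ * (‖a‖ * ‖c‖) :=
    (f.le_opNorm _).trans (by gcongr; exact norm_mul_le _ _)
  rw [innerDerivation_apply]
  refine (norm_sub_le _ _).trans ?_
  linarith

theorem isDualDerivation_innerDerivation (f : StrongDual ℂ A) :
    IsDualDerivation (innerDerivation f) := by
  intro a b c
  simp only [innerDerivation_apply, mul_assoc]
  ring

theorem IsDualDerivation.sub {D₁ D₂ : A →L[ℂ] StrongDual ℂ A} (h₁ : IsDualDerivation D₁)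
    (h₂ : IsDualDerivation D₂) : IsDualDerivation (D₁ - D₂) := by
  intro a b c
  simp only [sub_apply, h₁ a b c, h₂ a b c]
  ring

theorem norm_sub_innerDerivation_le (D : A →L[ℂ] StrongDual ℂ A) (f : StrongDual ℂ A) {r : ℝ}
    (hf : ‖f‖ ≤ r) : ‖D - innerDerivation f‖ ≤ ‖D‖ + 2 * r := by
  have h := norm_innerDerivation_le f
  calc ‖D - innerDerivation f‖ ≤ ‖D‖ + ‖innerDerivation f‖ := norm_sub_le D (innerDerivation f)
    _ ≤ ‖D‖ + 2 * r := by linarith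

/-- A derivation can be made to vanish on a contractive idempotent. -/
theorem IsDualDerivation.exists_apply_idempotent_eq {D : A →L[ℂ] StrongDual ℂ A}
    (hD : IsDualDerivation D) {e : A} (he : e * e = e) (hn : ‖e‖ ≤ 1) :
    ∃ g : StrongDual ℂ A, ‖g‖ ≤ 2 * ‖D‖ ∧ (D - innerDerivation g) e = 0 := by
  -- The functional is `e · De - De · e`. It works because `De = e · De + De · e`, and applying this
  -- identity to `e * c * e` gives `D e (e * c * e) = 0`.
  refine ⟨innerDerivation (D e) e, ?_, ?_⟩
  · calc ‖innerDerivation (D e) e‖ ≤ ‖innerDerivation (D e)‖ * ‖e‖ :=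
          ContinuousLinearMap.le_opNorm _ _
      _ ≤ (2 * (‖D‖ * ‖e‖)) * ‖e‖ := by
          gcongr
          exact (norm_innerDerivation_le _).trans (by gcongr; exact D.le_opNorm _)
      _ ≤ (2 * (‖D‖ * 1)) * 1 := by gcongr
      _ = 2 * ‖D‖ := by ring
  · ext c
    have h₁ := hD e e c
    have h₂ := hD e e (e * c * e)
    simp only [he, mul_assoc] at h₁ h₂
    rw [← mul_assoc e e (c * e), he] at h₂
    have h₃ : D e (e * (c * e)) = 0 := by
      have := sub_eq_zero.2 h₂
      simpa using this
    simp only [sub_apply, innerDerivation_apply, mul_assoc, he,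
      zero_apply, h₃, h₁]
    rw [← mul_assoc e e c, he]
    ring

/-- Averaging over signs: a diagonal sum of a bilinear map is bounded by its values at signed
sums. -/
theorem norm_add_sum_le_of_forall_signs {E F H κ : Type*} [NormedAddCommGroup E] [NormedSpace ℂ E]
    [NormedAddCommGroup F] [NormedSpace ℂ F] [NormedAddCommGroup H] [NormedSpace ℂ H]
    (B : E →L[ℂ] F →L[ℂ] H) (x : κ → E) (y : κ → F) (M : ℝ) (s : Finset κ) (z : E) (w : F)
    (h : ∀ ε : κ → ℂ, (∀ i, ‖ε i‖ ≤ 1) →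
      ‖B (z + ∑ i ∈ s, ε i • x i) (w + ∑ i ∈ s, ε i • y i)‖ ≤ M) :
    ‖B z w + ∑ i ∈ s, B (x i) (y i)‖ ≤ M := by
  classical
  induction s using Finset.induction_on generalizing z w with
  | empty => simpa using h (fun _ => 0) (by simp)
  | insert a s ha ih =>
    have key : ∀ η : ℂ, ‖η‖ ≤ 1 →
        ‖B (z + η • x a) (w + η • y a) + ∑ i ∈ s, B (x i) (y i)‖ ≤ M := by
      intro η hη
      refine ih _ _ fun ε hε => ?_
      have := h (Function.update ε a η) fun i => by
        by_cases hi : i = a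
        · subst hi; simpa using hη
        · simpa [hi] using hε i
      rw [Finset.sum_insert ha, Finset.sum_insert ha] at this
      have hup : ∀ i ∈ s, Function.update ε a η i = ε i := fun i hi =>
        Function.update_of_ne (ne_of_mem_of_not_mem hi ha) _ _
      have hx : ∑ i ∈ s, Function.update ε a η i • x i = ∑ i ∈ s, ε i • x i :=
        Finset.sum_congr rfl fun i hi => by rw [hup i hi]
      have hy : ∑ i ∈ s, Function.update ε a η i • y i = ∑ i ∈ s, ε i • y i :=
        Finset.sum_congr rfl fun i hi => by rw [hup i hi]
      rw [hx, hy] at this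
      simpa [add_assoc] using this
    have h₁ := key 1 (by simp)
    have h₂ := key (-1) (by simp)
    rw [Finset.sum_insert ha]
    -- Averaging over `η = ±1` cancels the cross terms `B z (y a)` and `B (x a) w`.
    have h₃ : (2 : ℂ) • (B z w + (B (x a) (y a) + ∑ i ∈ s, B (x i) (y i))) =
        (B (z + (1 : ℂ) • x a) (w + (1 : ℂ) • y a) + ∑ i ∈ s, B (x i) (y i)) +
        (B (z + (-1 : ℂ) • x a) (w + (-1 : ℂ) • y a) + ∑ i ∈ s, B (x i) (y i)) := by
      simp only [map_add, map_smul, add_apply, smul_apply]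
      module
    have h₄ := congrArg norm h₃
    rw [norm_smul] at h₄
    have h₅ := norm_add_le (B (z + (1 : ℂ) • x a) (w + (1 : ℂ) • y a) + ∑ i ∈ s, B (x i) (y i))
      (B (z + (-1 : ℂ) • x a) (w + (-1 : ℂ) • y a) + ∑ i ∈ s, B (x i) (y i))
    norm_num at h₄
    norm_num at h₁ h₂ h₅
    linarith

/-- Matrix units whose signed permutation matrices are contractive. -/
structure IsContractiveMatrixUnits {κ : Type*} [Fintype κ] [DecidableEq κ] (e : κ → κ → A) :
    Prop where
  mul_same : ∀ i j l, e i j * e j l = e i l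
  mul_ne : ∀ i j k l, j ≠ k → e i j * e k l = 0
  norm_signed_le : ∀ (σ : Equiv.Perm κ) (ε : κ → ℂ), (∀ i, ‖ε i‖ ≤ 1) →
    ‖∑ i, ε i • e i (σ i)‖ ≤ 1

section MatrixUnits

variable {κ : Type*} [Fintype κ] [DecidableEq κ] {e : κ → κ → A}

theorem IsContractiveMatrixUnits.mul_eq (he : IsContractiveMatrixUnits e) (i j k l : κ) :
    e i j * e k l = if j = k then e i l else 0 := by
  split_ifs with h
  · subst h; exact he.mul_same _ _ _
  · exact he.mul_ne _ _ _ _ h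

theorem IsContractiveMatrixUnits.norm_signed_le' (he : IsContractiveMatrixUnits e)
    (σ : Equiv.Perm κ) (ε : κ → ℂ) (hε : ∀ i, ‖ε i‖ ≤ 1) :
    ‖∑ i, ε i • e (σ i) i‖ ≤ 1 := by
  have := he.norm_signed_le σ.symm (fun i => ε (σ.symm i)) fun i => hε _
  rw [← Equiv.sum_comp σ] at this
  simpa using this

/-- A derivation which vanishes on the unit of a system of contractive matrix units can be made
to vanish on the matrix units. -/
theorem IsDualDerivation.exists_apply_matrixUnits_eq [AddGroup κ]
    {D : A →L[ℂ] StrongDual ℂ A} (hD : IsDualDerivation D) (he : IsContractiveMatrixUnits e)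
    (h0 : D (∑ i, e i i) = 0) :
    ∃ f : StrongDual ℂ A, ‖f‖ ≤ ‖D‖ ∧ ∀ k l, (D - innerDerivation f) (e k l) = 0 := by
  have hm : (0 : ℝ) < Fintype.card κ := by exact_mod_cast Fintype.card_pos
  have hmC : (Fintype.card κ : ℂ) ≠ 0 := by exact_mod_cast hm.ne'
  -- With `m` the cardinality of `κ`, `f₀ / m` is the average `(1 / m) ∑ e j i · D (e i j)` over the
  -- canonical diagonal of the matrix algebra.
  let f₀ : StrongDual ℂ A := ∑ i, ∑ j,
    (D (e i j)).comp ((ContinuousLinearMap.mul ℂ A).flip (e j i))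
  have hf₀ : ∀ c, f₀ c = ∑ i, ∑ j, D (e i j) (c * e j i) := by
    intro c
    simp [f₀]
  refine ⟨(Fintype.card κ : ℂ)⁻¹ • f₀, ?_, ?_⟩
  · refine ContinuousLinearMap.opNorm_le_bound _ (norm_nonneg D) fun c => ?_
    -- The substitution `j = i + k` splits the pairs `(i, j)` into the graphs of `m` translations.
    -- Each graph carries signed permutation matrices, so sign averaging bounds its sum by `‖D‖ *
    -- ‖c‖`. This is why `κ` is a group.
    have hre : f₀ c = ∑ k, ∑ i, D (e i (i + k)) (c * e (i + k) i) := by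
      rw [hf₀, Finset.sum_comm' (t' := Finset.univ) (s' := fun _ => Finset.univ) (by simp)]
      rw [Finset.sum_comm]
      conv_rhs => rw [Finset.sum_comm]
      exact Finset.sum_congr rfl fun i _ =>
        (Equiv.sum_comp (Equiv.addLeft i) fun j => D (e i j) (c * e j i)).symm
    have hk : ∀ k, ‖∑ i, D (e i (i + k)) (c * e (i + k) i)‖ ≤ ‖D‖ * ‖c‖ := by
      intro k
      have := norm_add_sum_le_of_forall_signs D (fun i => e i (i + k))
        (fun i => c * e (i + k) i) (‖D‖ * ‖c‖) Finset.univ 0 0 (by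
          intro ε hε
          have h₁ := he.norm_signed_le (Equiv.addRight k) ε hε
          have h₂ := he.norm_signed_le' (Equiv.addRight k) ε hε
          simp only [Equiv.coe_addRight] at h₁ h₂
          simp only [zero_add, ← mul_smul_comm, ← Finset.mul_sum]
          calc _ ≤ ‖D‖ * ‖∑ i, ε i • e i (i + k)‖ * ‖c * ∑ i, ε i • e (i + k) i‖ :=
                D.le_opNorm₂ _ _
            _ ≤ ‖D‖ * 1 * (‖c‖ * 1) := by
                gcongr
                exact (norm_mul_le _ _).trans (by gcongr)
            _ = _ := by ring)
      simpa using this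
    rw [smul_apply, norm_smul, norm_inv, RCLike.norm_natCast,
      inv_mul_le_iff₀ hm, hre]
    refine (norm_sum_le _ _).trans ((Finset.sum_le_sum fun k _ => hk k).trans ?_)
    simp
  · intro k l
    ext c
    have h1 : f₀ (c * e k l) = ∑ i, D (e i l) (c * e k i) := by
      rw [hf₀]
      refine Finset.sum_congr rfl fun i _ => ?_
      rw [Finset.sum_eq_single l]
      · rw [mul_assoc, he.mul_same]
      · intro j _ hj
        rw [mul_assoc, he.mul_ne _ _ _ _ hj.symm, mul_zero, map_zero]
      · simp
    -- The derivation rule for `e i j * e k l` produces the terms of `f₀ (c * e k l)` and, for each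
    -- of the `m` values of `i`, an error summing over `j` to `D (e k l) (c * ∑ i, e i i)`. Since
    -- `D` vanishes on the unit, that error is `D (e k l) c`.
    have h2 : f₀ (e k l * c) = ∑ i, D (e i l) (c * e k i) -
        Fintype.card κ * D (e k l) (c * ∑ i, e i i) := by
      have hij : ∀ i j, D (e i j) (e k l * c * e j i) =
          (if j = k then D (e i l) (c * e k i) else 0) - D (e k l) (c * e j j) := by
        intro i j
        have := hD (e i j) (e k l) (c * e j i)
        rw [he.mul_eq, mul_assoc c, he.mul_same, ← mul_assoc (e k l)] at this
        rw [eq_sub_iff_add_eq, add_comm, ← this]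
        split_ifs with h
        · rw [h]
        · simp
      rw [hf₀]
      simp only [hij, Finset.sum_sub_distrib, Finset.sum_ite_eq', Finset.mem_univ, if_true,
        Finset.mul_sum, map_sum, Finset.sum_const, Finset.card_univ, nsmul_eq_mul]
    have h3 : (∑ i, e i i) * e k l = e k l := by
      rw [Finset.sum_mul, Finset.sum_eq_single k]
      · exact he.mul_same _ _ _
      · intro i _ hi
        exact he.mul_ne _ _ _ _ hi
      · simp
    have h4 := hD (∑ i, e i i) (e k l) c
    rw [h3, h0, zero_apply, add_zero] at h4
    rw [sub_apply, sub_apply, innerDerivation_apply,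
      smul_apply, smul_apply, h1, h2, h4]
    simp only [smul_eq_mul, zero_apply]
    field_simp
    ring

/-- A derivation which vanishes on `m × m` matrix units is of order `1 / m` on a corner. -/
theorem IsDualDerivation.card_mul_norm_apply_le {D : A →L[ℂ] StrongDual ℂ A}
    (hD : IsDualDerivation D) (he : IsContractiveMatrixUnits e) (h0 : ∀ k l, D (e k l) = 0)
    (o : κ) (hdiag : ∀ a, ‖∑ k, e k o * a * e o k‖ ≤ ‖a‖) {a c : A} (ha : e o o * a = a)
    (hc : e o o * c = c) : Fintype.card κ * ‖D a c‖ ≤ ‖D‖ * ‖a‖ * ‖c‖ := by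
  have hl : ∀ k l x y, D (e k l * x) y = D x (y * e k l) := fun k l x y => by
    rw [hD, h0]; simp
  have hr : ∀ k l x y, D (x * e k l) y = D x (e k l * y) := fun k l x y => by
    rw [hD, h0]; simp
  -- `D` is now bilinear over the matrix units, so they can be moved to the other argument, where `e
  -- o k * e l o` survives only if `l = k`.
  have hkl : ∀ k l, D (e k o * a * e o k) (e l o * c * e o l) = if l = k then D a c else 0 := by
    intro k l
    rw [hr, hl]
    have : e o k * (e l o * c * e o l) * e k o = (e o k * e l o) * c * (e o l * e k o) := by
      simp only [mul_assoc]
    rw [this]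
    split_ifs with h
    · subst h
      rw [he.mul_same, hc, ← hl, ha]
    · rw [he.mul_ne _ _ _ _ h, mul_zero, map_zero]
  have hsum : D (∑ k, e k o * a * e o k) (∑ l, e l o * c * e o l) = Fintype.card κ * D a c := by
    simp only [map_sum, sum_apply, hkl]
    simp
  have := D.le_opNorm₂ (∑ k, e k o * a * e o k) (∑ l, e l o * c * e o l)
  rw [hsum, norm_mul, RCLike.norm_natCast] at this
  refine this.trans ?_
  gcongr
  · exact hdiag a
  · exact hdiag c

end MatrixUnits

/-- A Banach algebra with a left approximate identity of idempotents, each of which is the corner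
of arbitrarily large systems of contractive matrix units, is weakly amenable. -/
theorem weaklyAmenable_of_matrixUnits (P : ℕ → A) (hP : ∀ a, Tendsto (fun N => P N * a) atTop (𝓝 a))
    (hmat : ∀ N, ∃ e : ZMod (N + 1) → ZMod (N + 1) → A, IsContractiveMatrixUnits e ∧
      e 0 0 = P N ∧ ∀ a, ‖∑ k, e k 0 * a * e 0 k‖ ≤ ‖a‖) :
    WeaklyAmenable A := by
  intro D (hD : IsDualDerivation D)
  -- Constants: `‖g‖ ≤ 2 ‖D‖` leaves a derivation of norm at most `5 ‖D‖`, so `‖f‖ ≤ 5 ‖D‖` and `‖g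
  -- + f‖ ≤ 7 ‖D‖`. The final derivation has norm at most `(1 + 2 * 7) ‖D‖`.
  have happ : ∀ N, ∃ f : StrongDual ℂ A, ‖f‖ ≤ 7 * ‖D‖ ∧ ∀ a c,
      ‖(D - innerDerivation f) (P N * a) (P N * c)‖ ≤
        15 * ‖D‖ * ‖P N * a‖ * ‖P N * c‖ * (1 / ((N : ℝ) + 1)) := by
    intro N
    obtain ⟨e, he, h00, hdiag⟩ := hmat N
    have hE : (∑ i, e i i) * (∑ i, e i i) = ∑ i, e i i := by
      simp [Finset.sum_mul, Finset.mul_sum, he.mul_eq]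
    have hE1 : ‖∑ i, e i i‖ ≤ 1 := by
      simpa using he.norm_signed_le 1 (fun _ => 1) (by simp)
    obtain ⟨g, hg, hg0⟩ := hD.exists_apply_idempotent_eq hE hE1
    have hD₁ := hD.sub (isDualDerivation_innerDerivation g)
    have hn₁ := norm_sub_innerDerivation_le D g hg
    obtain ⟨f, hf, hf0⟩ := hD₁.exists_apply_matrixUnits_eq he hg0
    have hD₂ := hD₁.sub (isDualDerivation_innerDerivation f)
    have hn₂ := norm_sub_innerDerivation_le (D - innerDerivation g) f hf
    have hgf : D - innerDerivation (g + f) = D - innerDerivation g - innerDerivation f := by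
      ext a c
      simp
      ring
    have hPP : P N * P N = P N := by rw [← h00, he.mul_same]
    refine ⟨g + f, (norm_add_le _ _).trans (by linarith), fun a c => ?_⟩
    have := hD₂.card_mul_norm_apply_le he hf0 0 hdiag (a := P N * a) (c := P N * c)
      (by rw [h00, ← mul_assoc, hPP]) (by rw [h00, ← mul_assoc, hPP])
    rw [hgf, mul_one_div, le_div_iff₀ (by positivity), mul_comm]
    rw [ZMod.card] at this
    push_cast at this
    refine this.trans ?_
    gcongr
    linarith
  choose f hf hfa using happ
  -- Banach–Alaoglu along a free ultrafilter: no separability of `A` is needed to obtain a limit.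
  obtain ⟨F, -, hF⟩ := (WeakDual.isCompact_closedBall (𝕜 := ℂ) (E := A) 0 (7 * ‖D‖)
    ).ultrafilter_le_nhds ((hyperfilter ℕ).map fun N => StrongDual.toWeakDual (f N)) (by
      simp only [Ultrafilter.coe_map, le_principal_iff, mem_map]
      refine Filter.univ_mem' fun N => ?_
      simpa using hf N)
  have hlim : ∀ c, Tendsto (fun N => f N c) (hyperfilter ℕ) (𝓝 (F c)) := fun c =>
    ((WeakDual.eval_continuous c).tendsto F).comp hF
  have hU : (hyperfilter ℕ : Filter ℕ) ≤ atTop := Nat.hyperfilter_le_atTop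
  refine ⟨WeakDual.toStrongDual F, fun a c => ?_⟩
  have h₁ : Tendsto (fun N => (D - innerDerivation (f N)) a c) (hyperfilter ℕ)
      (𝓝 (D a c - (F (c * a) - F (a * c)))) := by
    simp only [sub_apply, innerDerivation_apply]
    exact tendsto_const_nhds.sub ((hlim _).sub (hlim _))
  have h₂ : Tendsto (fun N => (D - innerDerivation (f N)) a c) atTop (𝓝 0) := by
    have hpa := hP a
    have hpc := hP c
    have hbound : ∀ N, ‖(D - innerDerivation (f N)) a c‖ ≤
        15 * ‖D‖ * ‖P N * a‖ * ‖P N * c‖ * (1 / ((N : ℝ) + 1)) +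
        (15 * ‖D‖ * ‖a - P N * a‖ * ‖c‖ + 15 * ‖D‖ * ‖P N * a‖ * ‖c - P N * c‖) := by
      intro N
      have hn : ‖D - innerDerivation (f N)‖ ≤ 15 * ‖D‖ :=
        (norm_sub_innerDerivation_le D (f N) (hf N)).trans_eq (by ring)
      set D' := D - innerDerivation (f N) with hD'
      have hsplit : D' a c = D' (P N * a) (P N * c) +
          (D' (a - P N * a) c + D' (P N * a) (c - P N * c)) := by
        simp
      rw [hsplit]
      refine (norm_add_le _ _).trans (add_le_add (hfa N a c) ((norm_add_le _ _).trans ?_))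
      refine add_le_add ((D'.le_opNorm₂ _ _).trans ?_) ((D'.le_opNorm₂ _ _).trans ?_) <;> gcongr
    refine squeeze_zero_norm hbound ?_
    have ha0 : Tendsto (fun N => ‖a - P N * a‖) atTop (𝓝 0) := by
      simpa using ((tendsto_const_nhds (x := a)).sub hpa).norm
    have hc0 : Tendsto (fun N => ‖c - P N * c‖) atTop (𝓝 0) := by
      simpa using ((tendsto_const_nhds (x := c)).sub hpc).norm
    have := ((((tendsto_const_nhds (x := 15 * ‖D‖)).mul hpa.norm).mul hpc.norm).mul
      (tendsto_one_div_add_atTop_nhds_zero_nat (𝕜 := ℝ))).add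
      ((((tendsto_const_nhds (x := 15 * ‖D‖)).mul ha0).mul_const ‖c‖).add
        (((tendsto_const_nhds (x := 15 * ‖D‖)).mul hpa.norm).mul hc0))
    simpa using this
  have := tendsto_nhds_unique h₁ (h₂.mono_left hU)
  exact sub_eq_zero.1 this

end Derivations

/-! ### The disjointness property of `ℓ_p`- and `c₀`-sums. -/

section BlockSums

set_option linter.unusedSectionVars false

variable {G : ℕ → Type*} [∀ n, NormedAddCommGroup (G n)] [∀ n, NormedSpace ℂ (G n)]

variable (G) in
/-- A decomposition of `J` into blocks `G n` whose norm has the disjointness property shared by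
`ℓ_p`-sums and `c₀`-sums. -/
structure BlockDecomposition (J : Type*) [NormedAddCommGroup J] [NormedSpace ℂ J] where
  /-- the inclusion of a block -/
  incl : ∀ n, G n →L[ℂ] J
  /-- the projection to a block -/
  proj : ∀ n, J →L[ℂ] G n
  norm_incl : ∀ n g, ‖incl n g‖ = ‖g‖
  proj_incl_same : ∀ n g, proj n (incl n g) = g
  proj_incl_ne : ∀ m n g, m ≠ n → proj m (incl n g) = 0
  tendsto_sum : ∀ x,
    Tendsto (fun N => ∑ n ∈ Finset.range N, incl n (proj n x)) atTop (𝓝 x)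
  norm_sum_le : ∀ {κ : Type} [Fintype κ] (S T : κ → Finset ℕ),
    Pairwise (Function.onFun Disjoint S) → Pairwise (Function.onFun Disjoint T) →
    ∀ (x : J) (y : κ → J), (∀ k, ∑ n ∈ T k, incl n (proj n (y k)) = y k) →
      (∀ k, ‖y k‖ ≤ ‖∑ n ∈ S k, incl n (proj n x)‖) → ‖∑ k, y k‖ ≤ ‖x‖

theorem norm_sum_single_le {p : ℝ≥0∞} [Fact (1 ≤ p)] (S : Finset ℕ) (x : lp G p) :
    ‖∑ n ∈ S, lp.single p n (x n)‖ ≤ ‖x‖ := by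
  classical
  refine lp.norm_mono (one_pos.trans_le Fact.out).ne' fun i => ?_
  rw [lp.coeFn_sum, Finset.sum_apply]
  by_cases hi : i ∈ S
  · rw [Finset.sum_eq_single_of_mem i hi fun n _ hn => lp.single_apply_ne _ _ _ hn.symm,
      lp.single_apply_self]
  · rw [Finset.sum_eq_zero fun n hn => lp.single_apply_ne _ _ _ (ne_of_mem_of_not_mem hn hi).symm]
    simp

/-- Replacing disjoint parts of a vector in an `ℓ_p`-sum by disjoint vectors of smaller norm. -/
theorem norm_sum_le_of_disjoint {p : ℝ≥0∞} [Fact (1 ≤ p)] {κ : Type*} [Fintype κ]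
    (S T : κ → Finset ℕ) (hS : Pairwise (Function.onFun Disjoint S))
    (hT : Pairwise (Function.onFun Disjoint T)) (x : lp G p) (y : κ → lp G p)
    (hy : ∀ k, ∀ n ∉ T k, y k n = 0)
    (hxy : ∀ k, ‖y k‖ ≤ ‖∑ n ∈ S k, lp.single p n (x n)‖) : ‖∑ k, y k‖ ≤ ‖x‖ := by
  classical
  have hp0 : p ≠ 0 := (one_pos.trans_le Fact.out).ne'
  have hsame : ∀ k, ∀ n ∈ T k, (∑ k, y k : lp G p) n = y k n := by
    intro k n hn
    rw [lp.coeFn_sum, Finset.sum_apply, Finset.sum_eq_single_of_mem k (Finset.mem_univ _)]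
    intro l _ hl
    exact hy l n (Finset.disjoint_left.1 (hT hl.symm) hn)
  have hnot : ∀ n, (∀ k, n ∉ T k) → (∑ k, y k : lp G p) n = 0 := by
    intro n hn
    rw [lp.coeFn_sum, Finset.sum_apply]
    exact Finset.sum_eq_zero fun k _ => hy k n (hn k)
  rcases eq_or_ne p ∞ with rfl | hp
  · refine lp.norm_le_of_forall_le (norm_nonneg _) fun n => ?_
    by_cases hn : ∃ k, n ∈ T k
    · obtain ⟨k, hk⟩ := hn
      rw [hsame k n hk]
      exact (lp.norm_apply_le_norm hp0 _ _).trans ((hxy k).trans (norm_sum_single_le _ _))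
    · push Not at hn
      rw [hnot n hn]
      simp
  · have hpr : 0 < p.toReal := ENNReal.toReal_pos hp0 hp
    refine lp.norm_le_of_forall_sum_le hpr (norm_nonneg _) fun s => ?_
    have hdT : ((Finset.univ : Finset κ) : Set κ).PairwiseDisjoint T := fun _ _ _ _ h => hT h
    have hdS : ((Finset.univ : Finset κ) : Set κ).PairwiseDisjoint S := fun _ _ _ _ h => hS h
    calc ∑ n ∈ s, ‖(∑ k, y k : lp G p) n‖ ^ p.toReal
        -- The index set is enlarged to contain every `T k`. Coordinates outside these sets vanish,
        -- so the sum then breaks up over `k`.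
        ≤ ∑ n ∈ s ∪ Finset.univ.biUnion T, ‖(∑ k, y k : lp G p) n‖ ^ p.toReal :=
          Finset.sum_le_sum_of_subset_of_nonneg Finset.subset_union_left
            fun _ _ _ => by positivity
      _ = ∑ n ∈ Finset.univ.biUnion T, ‖(∑ k, y k : lp G p) n‖ ^ p.toReal := by
          refine (Finset.sum_subset Finset.subset_union_right fun n _ hn => ?_).symm
          rw [hnot n (by simpa using hn), norm_zero, Real.zero_rpow hpr.ne']
      _ = ∑ k, ∑ n ∈ T k, ‖(∑ k, y k : lp G p) n‖ ^ p.toReal := Finset.sum_biUnion hdT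
      _ = ∑ k, ∑ n ∈ T k, ‖y k n‖ ^ p.toReal :=
          Finset.sum_congr rfl fun k _ => Finset.sum_congr rfl fun n hn => by rw [hsame k n hn]
      _ ≤ ∑ k, ‖y k‖ ^ p.toReal :=
          Finset.sum_le_sum fun k _ => lp.sum_rpow_le_norm_rpow hpr _ _
      _ ≤ ∑ k, ‖∑ n ∈ S k, lp.single p n (x n)‖ ^ p.toReal :=
          Finset.sum_le_sum fun k _ => Real.rpow_le_rpow (norm_nonneg _) (hxy k) hpr.le
      _ = ∑ k, ∑ n ∈ S k, ‖x n‖ ^ p.toReal :=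
          Finset.sum_congr rfl fun k _ => lp.norm_sum_single hpr _ _
      _ = ∑ n ∈ Finset.univ.biUnion S, ‖x n‖ ^ p.toReal := (Finset.sum_biUnion hdS).symm
      _ ≤ ‖x‖ ^ p.toReal := lp.sum_rpow_le_norm_rpow hpr _ _

/-- A space which embeds isometrically into an `ℓ_p`-sum, with finitely supported sequences
dense, has a block decomposition. -/
theorem nonempty_blockDecomposition {p : ℝ≥0∞} [Fact (1 ≤ p)] {J : Type*} [NormedAddCommGroup J]
    [NormedSpace ℂ J] (L : J →ₗᵢ[ℂ] lp G p) (hL : ∀ n g, ∃ x, L x = lp.single p n g)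
    (hsum : ∀ x, Tendsto (fun N => ∑ n ∈ Finset.range N, lp.single p n (L x n)) atTop
      (𝓝 (L x))) : Nonempty (BlockDecomposition G J) := by
  classical
  have hp0 : 0 < p := one_pos.trans_le Fact.out
  choose s hs using hL
  let incl : ∀ n, G n →ₗᵢ[ℂ] J := fun n =>
    { toFun := s n
      map_add' := fun a b => L.injective (by simp [hs, lp.single_add])
      map_smul' := fun c a => L.injective (by simp [hs, lp.single_smul])
      norm_map' := fun a => by
        change ‖s n a‖ = ‖a‖
        rw [← L.norm_map, hs, lp.norm_single hp0] }
  have hincl : ∀ n g, L (incl n g) = lp.single p n g := hs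
  let proj : ∀ n, J →L[ℂ] G n := fun n => (lp.evalCLM ℂ G p n).comp L.toContinuousLinearMap
  have hproj : ∀ n x, proj n x = L x n := fun n x => rfl
  have hband : ∀ (S : Finset ℕ) x,
      L (∑ n ∈ S, incl n (proj n x)) = ∑ n ∈ S, lp.single p n (L x n) := fun S x => by
    rw [map_sum]
    exact Finset.sum_congr rfl fun n _ => hincl _ _
  exact ⟨{
    incl := fun n => (incl n).toContinuousLinearMap
    proj := proj
    norm_incl := fun n g => (incl n).norm_map g
    proj_incl_same := fun n g => by
      change L (incl n g) n = g
      rw [hincl, lp.single_apply_self]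
    proj_incl_ne := fun m n g h => by
      change L (incl n g) m = 0
      rw [hincl, lp.single_apply_ne _ _ _ h]
    tendsto_sum := fun x => by
      refine L.isometry.isEmbedding.tendsto_nhds_iff.2 ?_
      refine (hsum x).congr fun N => (hband _ _).symm
    norm_sum_le := fun S T hS hT x y hy hxy => by
      rw [← L.norm_map, map_sum, ← L.norm_map x]
      refine norm_sum_le_of_disjoint S T hS hT (L x) (fun k => L (y k)) (fun k n hn => ?_)
        fun k => ?_
      · have := congrArg (fun z => L z n) (hy k)
        refine this.symm.trans ?_
        change (L (∑ n ∈ T k, incl n (proj n (y k)))) n = 0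
        rw [hband, lp.coeFn_sum, Finset.sum_apply]
        exact Finset.sum_eq_zero fun m hm =>
          lp.single_apply_ne _ _ _ (ne_of_mem_of_not_mem hm hn).symm
      · rw [← hband, L.norm_map, L.norm_map]
        exact hxy k }⟩

theorem tendsto_sum_single_of_tendsto_zero (x : lp G ∞)
    (hx : Tendsto (fun n => ‖x n‖) atTop (𝓝 0)) :
    Tendsto (fun N => ∑ n ∈ Finset.range N, lp.single ∞ n (x n)) atTop (𝓝 x) := by
  classical
  rw [Metric.tendsto_atTop]
  intro ε hε
  obtain ⟨N, hN⟩ := Filter.eventually_atTop.1 (hx.eventually_lt_const (half_pos hε))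
  refine ⟨N, fun M hM => ?_⟩
  rw [dist_eq_norm]
  refine (lp.norm_le_of_forall_le (half_pos hε).le fun n => ?_).trans_lt (half_lt_self hε)
  rw [lp.coeFn_sub, Pi.sub_apply, lp.coeFn_sum, Finset.sum_apply]
  by_cases hn : n ∈ Finset.range M
  · rw [Finset.sum_eq_single_of_mem n hn fun m _ hm => lp.single_apply_ne _ _ _ hm.symm,
      lp.single_apply_self, sub_self, norm_zero]
    positivity
  · rw [Finset.sum_eq_zero fun m hm => lp.single_apply_ne _ _ _ (ne_of_mem_of_not_mem hm hn).symm,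
      zero_sub, norm_neg]
    exact (hN n (hM.trans (by simpa using hn))).le

/-- The `c₀`-sum is treated as a subspace of `lp G ∞`, where the null condition replaces `p < ∞` in
the convergence of truncations. From here on `p` plays no role. -/
theorem IsJohnsonSpace.nonempty_blockDecomposition {J : Type*} [NormedAddCommGroup J]
    [NormedSpace ℂ J] (hJ : IsJohnsonSpace G J) : Nonempty (BlockDecomposition G J) := by
  classical
  rcases hJ.isSum with ⟨⟨L⟩⟩ | ⟨p, hp1, hp, ⟨L⟩⟩
  · refine BanachOp.nonempty_blockDecomposition
      ((c0Sum G).subtypeₗᵢ.comp L.toLinearIsometry) (fun n g => ?_) fun x =>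
        tendsto_sum_single_of_tendsto_zero _ (L x).2
    have hmem : lp.single ∞ n g ∈ c0Sum G := by
      change Tendsto (fun m => ‖lp.single ∞ n g m‖) atTop (𝓝 0)
      refine tendsto_const_nhds.congr' ?_
      filter_upwards [eventually_gt_atTop n] with m hm
      rw [lp.single_apply_ne _ _ _ hm.ne', norm_zero]
    exact ⟨L.symm ⟨_, hmem⟩, by simp⟩
  · exact BanachOp.nonempty_blockDecomposition L.toLinearIsometry
      (fun n g => ⟨L.symm (lp.single p n g), by simp⟩) fun x =>
        (lp.hasSum_single hp (L x)).tendsto_sum_nat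

end BlockSums

/-! ### Approximable operators and strong convergence. -/

section Approximable

variable {X Y V : Type*} [NormedAddCommGroup X] [NormedSpace ℂ X]
  [NormedAddCommGroup Y] [NormedSpace ℂ Y] [NormedAddCommGroup V] [NormedSpace ℂ V]

theorem finiteRank_le_approximable : finiteRank X Y ≤ approximable X Y :=
  Submodule.le_topologicalClosure _

theorem comp_mem_finiteRank [FiniteDimensional ℂ V] (S : V →L[ℂ] Y) (T : X →L[ℂ] V) :
    S.comp T ∈ finiteRank X Y := by
  change FiniteDimensional ℂ (LinearMap.range ((S : V →ₗ[ℂ] Y) ∘ₗ (T : X →ₗ[ℂ] V)))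
  rw [LinearMap.range_comp]
  infer_instance

/-- Strong convergence to the identity of a bounded sequence is uniform on approximable
operators. -/
theorem tendsto_comp_of_mem_approximable (P : ℕ → Y →L[ℂ] Y) (hP1 : ∀ N, ‖P N‖ ≤ 1)
    (hP : ∀ y, Tendsto (fun N => P N y) atTop (𝓝 y)) {T : X →L[ℂ] Y} (hT : T ∈ approximable X Y) :
    Tendsto (fun N => (P N).comp T) atTop (𝓝 T) := by
  have hfin : ∀ T ∈ finiteRank X Y, Tendsto (fun N => (P N).comp T) atTop (𝓝 T) := by
    intro T hT
    have : FiniteDimensional ℂ (LinearMap.range (T : X →ₗ[ℂ] Y)) := hT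
    let b := Module.finBasis ℂ (LinearMap.range (T : X →ₗ[ℂ] Y))
    let T' : X →L[ℂ] LinearMap.range (T : X →ₗ[ℂ] Y) :=
      T.codRestrict _ fun x => ⟨x, rfl⟩
    let φ : ∀ i, StrongDual ℂ X := fun i => (LinearMap.toContinuousLinearMap (b.coord i)).comp T'
    have hφ : ∀ x, ∑ i, φ i x • (b i : Y) = T x := by
      intro x
      refine Eq.trans ?_ (congrArg Subtype.val (b.sum_repr (T' x)))
      rw [AddSubmonoidClass.coe_finsetSum]
      rfl
    have hTsum : ∀ N, (P N).comp T =
        ∑ i, ContinuousLinearMap.smulRightL ℂ X Y (φ i) (P N (b i)) := by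
      intro N
      ext x
      simp [← hφ x]
    have hTsum' : T = ∑ i, ContinuousLinearMap.smulRightL ℂ X Y (φ i) (b i) := by
      ext x
      simp [← hφ x]
    simp only [hTsum]
    conv => rhs; rw [hTsum']
    exact tendsto_finsetSum _ fun i _ =>
      ((ContinuousLinearMap.smulRightL ℂ X Y (φ i)).continuous.tendsto _).comp (hP _)
  rw [Metric.tendsto_atTop]
  intro ε hε
  obtain ⟨T', hT', hd⟩ := Metric.mem_closure_iff.1
    (show T ∈ closure (finiteRank X Y : Set (X →L[ℂ] Y)) from hT) (ε / 3) (by positivity)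
  obtain ⟨N, hN⟩ := Metric.tendsto_atTop.1 (hfin T' hT') (ε / 3) (by positivity)
  refine ⟨N, fun M hM => ?_⟩
  have h₁ : dist ((P M).comp T) ((P M).comp T') ≤ dist T T' := by
    rw [dist_eq_norm, dist_eq_norm, ← ContinuousLinearMap.comp_sub]
    refine ((P M).opNorm_comp_le _).trans ?_
    exact mul_le_of_le_one_left (norm_nonneg _) (hP1 M)
  have h₂ := hN M hM
  have h₃ := dist_triangle4 ((P M).comp T) ((P M).comp T') T' T
  rw [dist_comm T' T] at h₃
  linarith

end Approximable

/-! ### Copies of initial blocks and matrix units in `𝒜(J)`. -/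

/-- The maps `τ k` are injective on `{0, …, N - 1}`, with disjoint images. -/
def DisjointCopies {κ : Type*} (N : ℕ) (τ : κ → ℕ → ℕ) : Prop :=
  ∀ k l, ∀ m < N, ∀ n < N, τ k m = τ l n → k = l ∧ m = n

namespace BlockDecomposition

variable {G : ℕ → Type*} [∀ n, NormedAddCommGroup (G n)] [∀ n, NormedSpace ℂ (G n)]
  {J : Type*} [NormedAddCommGroup J] [NormedSpace ℂ J] (d : BlockDecomposition G J)

/-- The projection onto the blocks in `S`. -/
def band (S : Finset ℕ) : J →L[ℂ] J := ∑ n ∈ S, (d.incl n).comp (d.proj n)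

theorem band_apply (S : Finset ℕ) (x : J) : d.band S x = ∑ n ∈ S, d.incl n (d.proj n x) := by
  simp [band]

theorem proj_band_of_mem {S : Finset ℕ} {n : ℕ} (hn : n ∈ S) (x : J) :
    d.proj n (d.band S x) = d.proj n x := by
  rw [band_apply, map_sum, Finset.sum_eq_single_of_mem n hn fun m _ hm =>
    d.proj_incl_ne _ _ _ hm.symm, d.proj_incl_same]

theorem band_incl_of_mem {S : Finset ℕ} {n : ℕ} (hn : n ∈ S) (g : G n) :
    d.band S (d.incl n g) = d.incl n g := by
  rw [band_apply, Finset.sum_eq_single_of_mem n hn fun m _ hm => by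
    rw [d.proj_incl_ne _ _ _ hm, map_zero], d.proj_incl_same]

/-- The norm inequality for disjoint families, in terms of band projections. -/
theorem norm_sum_le_band {κ : Type} [Fintype κ] (S T : κ → Finset ℕ)
    (hS : Pairwise (Function.onFun Disjoint S)) (hT : Pairwise (Function.onFun Disjoint T))
    (x : J) (y : κ → J) (hy : ∀ k, d.band (T k) (y k) = y k)
    (hxy : ∀ k, ‖y k‖ ≤ ‖d.band (S k) x‖) : ‖∑ k, y k‖ ≤ ‖x‖ :=
  d.norm_sum_le S T hS hT x y (fun k => by rw [← band_apply, hy])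
    fun k => by rw [← band_apply]; exact hxy k

/-- The disjointness property for singletons. It makes band projections and the maps to and from
copies contractive. -/
theorem norm_sum_incl_le (s : Finset ℕ) (α β : ℕ → ℕ) (hα : Set.InjOn α s) (hβ : Set.InjOn β s)
    (x : J) (g : ∀ n, G (α n)) (hg : ∀ n ∈ s, ‖g n‖ ≤ ‖d.proj (β n) x‖) :
    ‖∑ n ∈ s, d.incl (α n) (g n)‖ ≤ ‖x‖ := by
  rw [← Finset.sum_coe_sort]
  refine d.norm_sum_le_band (κ := s) (fun n => {β n}) (fun n => {α n}) ?_ ?_ x _ ?_ ?_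
  · intro m n hmn
    simpa [Function.onFun] using fun h => hmn (Subtype.ext (hβ m.2 n.2 h))
  · intro m n hmn
    simpa [Function.onFun] using fun h => hmn (Subtype.ext (hα m.2 n.2 h))
  · intro n
    exact d.band_incl_of_mem (Finset.mem_singleton_self _) _
  · intro n
    rw [band_apply, Finset.sum_singleton, d.norm_incl, d.norm_incl]
    exact hg n n.2

theorem norm_band_apply_le (S : Finset ℕ) (x : J) : ‖d.band S x‖ ≤ ‖x‖ := by
  rw [band_apply]
  exact d.norm_sum_incl_le S id id (Set.injOn_id _) (Set.injOn_id _) x _ fun n _ => le_rfl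

theorem norm_proj_apply_le (n : ℕ) (x : J) : ‖d.proj n x‖ ≤ ‖x‖ := by
  have := d.norm_band_apply_le {n} x
  rwa [band_apply, Finset.sum_singleton, d.norm_incl] at this

theorem tendsto_band_comp {X : Type*} [NormedAddCommGroup X] [NormedSpace ℂ X] {T : X →L[ℂ] J}
    (hT : T ∈ approximable X J) :
    Tendsto (fun N => (d.band (Finset.range N)).comp T) atTop (𝓝 T) :=
  tendsto_comp_of_mem_approximable _
    (fun N => ContinuousLinearMap.opNorm_le_bound _ zero_le_one fun x => by
      simpa using d.norm_band_apply_le _ x)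
    (fun y => by simpa only [band_apply] using d.tendsto_sum y) hT

section Copies

set_option linter.unusedSectionVars false

variable {κ : Type} [Fintype κ] [DecidableEq κ] {N : ℕ} {τ : κ → ℕ → ℕ}
  (w : ∀ k n, G n ≃ₗᵢ[ℂ] G (τ k n))

variable (N) in
/-- The isometry from the first `N` blocks onto their `k`-th copy. -/
def toCopy (k : κ) : J →L[ℂ] J :=
  ∑ n ∈ Finset.range N,
    (d.incl (τ k n)).comp ((w k n).toContinuousLinearEquiv.toContinuousLinearMap.comp (d.proj n))

variable (N) in
/-- The isometry from the `k`-th copy of the first `N` blocks onto the first `N` blocks. -/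
def ofCopy (k : κ) : J →L[ℂ] J :=
  ∑ n ∈ Finset.range N, (d.incl n).comp
    ((w k n).symm.toContinuousLinearEquiv.toContinuousLinearMap.comp (d.proj (τ k n)))

theorem toCopy_apply (k : κ) (x : J) :
    d.toCopy N w k x = ∑ n ∈ Finset.range N, d.incl (τ k n) (w k n (d.proj n x)) := by
  simp [toCopy]

theorem ofCopy_apply (k : κ) (x : J) :
    d.ofCopy N w k x = ∑ n ∈ Finset.range N, d.incl n ((w k n).symm (d.proj (τ k n) x)) := by
  simp [ofCopy]

theorem ofCopy_mem_approximable [∀ n, FiniteDimensional ℂ (G n)] (k : κ) :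
    d.ofCopy N w k ∈ approximable J J :=
  Submodule.sum_mem _ fun _ _ => finiteRank_le_approximable (comp_mem_finiteRank _ _)

theorem proj_ofCopy {n : ℕ} (hn : n < N) (k : κ) (x : J) :
    d.proj n (d.ofCopy N w k x) = (w k n).symm (d.proj (τ k n) x) := by
  rw [ofCopy_apply, map_sum, Finset.sum_eq_single_of_mem n (Finset.mem_range.2 hn) fun m _ hm =>
    d.proj_incl_ne _ _ _ hm.symm, d.proj_incl_same]

theorem toCopy_ofCopy (k : κ) (hk : Set.InjOn (τ k) (Finset.range N)) (x : J) :
    d.toCopy N w k (d.ofCopy N w k x) = d.band ((Finset.range N).image (τ k)) x := by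
  rw [toCopy_apply, band_apply, Finset.sum_image hk]
  refine Finset.sum_congr rfl fun n hn => ?_
  rw [proj_ofCopy d w (Finset.mem_range.1 hn), LinearIsometryEquiv.apply_symm_apply]

theorem band_toCopy (k : κ) (x : J) :
    d.band ((Finset.range N).image (τ k)) (d.toCopy N w k x) = d.toCopy N w k x := by
  rw [toCopy_apply, map_sum]
  exact Finset.sum_congr rfl fun n hn => d.band_incl_of_mem (Finset.mem_image_of_mem _ hn) _

theorem ofCopy_band (k : κ) (x : J) :
    d.ofCopy N w k (d.band ((Finset.range N).image (τ k)) x) = d.ofCopy N w k x := by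
  rw [ofCopy_apply, ofCopy_apply]
  exact Finset.sum_congr rfl fun n hn => by rw [d.proj_band_of_mem (Finset.mem_image_of_mem _ hn)]

theorem injOn_of_copies (hτ : DisjointCopies N τ) (k : κ) : Set.InjOn (τ k) (Finset.range N) := by
  intro m hm n hn h
  exact (hτ k k m (by simpa using hm) n (by simpa using hn) h).2

theorem pairwise_disjoint_copies (hτ : DisjointCopies N τ) :
    Pairwise (Function.onFun Disjoint fun k => (Finset.range N).image (τ k)) := by
  intro k l hkl
  refine Finset.disjoint_left.2 fun a ha hb => ?_
  obtain ⟨m, hm, rfl⟩ := Finset.mem_image.1 ha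
  obtain ⟨n, hn, h⟩ := Finset.mem_image.1 hb
  exact hkl (hτ l k n (Finset.mem_range.1 hn) m (Finset.mem_range.1 hm) h).1.symm

theorem ofCopy_toCopy (hτ : DisjointCopies N τ) (j k : κ) (x : J) :
    d.ofCopy N w j (d.toCopy N w k x) = if j = k then d.band (Finset.range N) x else 0 := by
  rw [ofCopy_apply]
  have key : ∀ n ∈ Finset.range N, d.proj (τ j n) (d.toCopy N w k x) =
      if j = k then w j n (d.proj n x) else 0 := by
    intro n hn
    rw [toCopy_apply, map_sum]
    split_ifs with h
    · subst h
      rw [Finset.sum_eq_single_of_mem n hn, d.proj_incl_same]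
      intro m hm hmn
      refine d.proj_incl_ne _ _ _ fun h => hmn ?_
      exact (hτ j j n (Finset.mem_range.1 hn) m (Finset.mem_range.1 hm) h).2.symm
    · refine Finset.sum_eq_zero fun m hm => d.proj_incl_ne _ _ _ fun h' => h ?_
      exact (hτ j k n (Finset.mem_range.1 hn) m (Finset.mem_range.1 hm) h').1
  rw [Finset.sum_congr rfl fun n hn => by rw [key n hn]]
  split_ifs with h
  · simp [band_apply]
  · simp

theorem norm_toCopy_apply_le (hτ : DisjointCopies N τ) (k : κ) (x : J) :
    ‖d.toCopy N w k x‖ ≤ ‖x‖ := by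
  rw [toCopy_apply]
  exact d.norm_sum_incl_le _ (τ k) id (injOn_of_copies hτ k) (Set.injOn_id _) x _
    fun n _ => by simp

theorem norm_ofCopy_apply_le (hτ : DisjointCopies N τ) (k : κ) (x : J) :
    ‖d.ofCopy N w k x‖ ≤ ‖x‖ := by
  rw [ofCopy_apply]
  exact d.norm_sum_incl_le _ id (τ k) (Set.injOn_id _) (injOn_of_copies hτ k) x _
    fun n _ => by simp

theorem band_ofCopy (k : κ) (x : J) :
    d.band (Finset.range N) (d.ofCopy N w k x) = d.ofCopy N w k x := by
  rw [ofCopy_apply, map_sum]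
  exact Finset.sum_congr rfl fun n hn => d.band_incl_of_mem hn _

/-- A family of contractions between copies acts contractively on their sum. -/
theorem norm_sum_toCopy_ofCopy_le (hτ : DisjointCopies N τ) (σ : Equiv.Perm κ) (r : ℝ)
    (hr : 0 ≤ r) (t : κ → J →L[ℂ] J)
    (ht : ∀ k x, ‖t k x‖ ≤ r * ‖x‖) (x : J) :
    ‖∑ k, d.toCopy N w k (t k (d.ofCopy N w (σ k) x))‖ ≤ r * ‖x‖ := by
  have hdisj := pairwise_disjoint_copies hτ
  -- The disjointness property compares norms with constant `1`, so the factor `r` is absorbed into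
  -- the vector `x`.
  have := d.norm_sum_le_band (fun k => (Finset.range N).image (τ (σ k)))
    (fun k => (Finset.range N).image (τ k)) (fun k l hkl => hdisj (σ.injective.ne hkl)) hdisj
    ((r : ℂ) • x) (fun k => d.toCopy N w k (t k (d.ofCopy N w (σ k) x)))
    (fun k => d.band_toCopy w k _) fun k => by
      rw [map_smul, norm_smul, Complex.norm_of_nonneg hr, ← d.ofCopy_band]
      refine (d.norm_toCopy_apply_le w hτ k _).trans ((ht k _).trans ?_)
      gcongr
      exact d.norm_ofCopy_apply_le w hτ _ _
  rwa [norm_smul, Complex.norm_of_nonneg hr] at this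

end Copies

variable [∀ n, FiniteDimensional ℂ (G n)]

theorem band_mem_approximable (S : Finset ℕ) : d.band S ∈ approximable J J :=
  Submodule.sum_mem _ fun _ _ => finiteRank_le_approximable (comp_mem_finiteRank _ _)

/-- Copies of the first `N` blocks yield contractive matrix units in `𝒜(J)`. -/
theorem exists_matrixUnits {κ : Type} [Fintype κ] [DecidableEq κ] {N : ℕ} {τ : κ → ℕ → ℕ}
    (w : ∀ k n, G n ≃ₗᵢ[ℂ] G (τ k n))
    (hτ : DisjointCopies N τ) (o : κ)
    (ho : ∀ n, τ o n = n) :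
    ∃ e : κ → κ → approximableAlgebra J, IsContractiveMatrixUnits e ∧
      e o o = ⟨d.band (Finset.range N), d.band_mem_approximable _⟩ ∧
      ∀ a, ‖∑ k, e k o * a * e o k‖ ≤ ‖a‖ := by
  let e : κ → κ → approximableAlgebra J := fun i j =>
    ⟨(d.toCopy N w i).comp (d.ofCopy N w j),
      comp_mem_approximable _ (d.ofCopy_mem_approximable w j)⟩
  have he : ∀ i j x, (e i j : J →L[ℂ] J) x = d.toCopy N w i (d.ofCopy N w j x) :=
    fun _ _ _ => rfl
  have hmul : ∀ (a b : approximableAlgebra J) x,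
      ((a * b : approximableAlgebra J) : J →L[ℂ] J) x = (a : J →L[ℂ] J) ((b : J →L[ℂ] J) x) :=
    fun _ _ _ => rfl
  have hsum : ∀ (f : κ → approximableAlgebra J) x,
      ((∑ k, f k : approximableAlgebra J) : J →L[ℂ] J) x = ∑ k, (f k : J →L[ℂ] J) x := by
    intro f x
    simp
  refine ⟨e, ⟨?_, ?_, ?_⟩, ?_, ?_⟩
  · intro i j l
    refine Subtype.ext (ContinuousLinearMap.ext fun x => ?_)
    rw [hmul, he, he, he, d.ofCopy_toCopy w hτ, if_pos rfl, d.band_ofCopy]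
  · intro i j k l hjk
    refine Subtype.ext (ContinuousLinearMap.ext fun x => ?_)
    rw [hmul, he, he, d.ofCopy_toCopy w hτ, if_neg hjk, map_zero]
    rfl
  · intro σ ε hε
    refine ContinuousLinearMap.opNorm_le_bound _ zero_le_one fun x => ?_
    have := d.norm_sum_toCopy_ofCopy_le w hτ σ 1 zero_le_one
      (fun k => ε k • ContinuousLinearMap.id ℂ J) (fun k x => by
        simpa [norm_smul] using mul_le_of_le_one_left (norm_nonneg x) (hε k)) x
    refine le_trans (le_of_eq (congrArg norm ((hsum _ x).trans ?_))) this
    refine Finset.sum_congr rfl fun k _ => ?_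
    change ε k • (e k (σ k) : J →L[ℂ] J) x = _
    rw [he]
    simp
  · refine Subtype.ext (ContinuousLinearMap.ext fun x => ?_)
    rw [he, d.toCopy_ofCopy w o (injOn_of_copies hτ o)]
    have : (Finset.range N).image (τ o) = Finset.range N := by
      rw [show τ o = id from funext ho, Finset.image_id]
    rw [this]
  · intro a
    refine ContinuousLinearMap.opNorm_le_bound _ (norm_nonneg _) fun x => ?_
    -- The diagonal amplification of `a` acts on each copy as the compression of `a` to copy `o`,
    -- hence with norm at most `‖a‖`.
    have := d.norm_sum_toCopy_ofCopy_le w hτ 1 ‖a‖ (norm_nonneg _)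
      (fun k => (d.ofCopy N w o).comp ((a : J →L[ℂ] J).comp (d.toCopy N w o))) (fun k x => by
        refine (d.norm_ofCopy_apply_le w hτ _ _).trans
          (((a : J →L[ℂ] J).le_opNorm _).trans ?_)
        exact mul_le_mul_of_nonneg_left (d.norm_toCopy_apply_le w hτ _ _) (norm_nonneg _)) x
    exact le_trans (le_of_eq (congrArg norm (hsum _ x))) this

theorem weaklyAmenable (d : BlockDecomposition G J)
    (hinf : ∀ i, {n | Nonempty (G n ≃ₗᵢ[ℂ] G i)}.Infinite) :
    WeaklyAmenable (approximableAlgebra J) := by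
  refine weaklyAmenable_of_matrixUnits
    (fun N => ⟨d.band (Finset.range N), d.band_mem_approximable _⟩) ?_ fun N => ?_
  · rintro ⟨a, ha⟩
    rw [tendsto_subtype_rng]
    exact d.tendsto_band_comp ha
  · obtain ⟨φ, hφ, hφG⟩ := extraction_forall_of_frequently
      (P := fun j k => Nonempty (G k ≃ₗᵢ[ℂ] G j.unpair.2) ∧ N ≤ k) fun j =>
        (Nat.frequently_atTop_iff_infinite.2 (hinf j.unpair.2)).and_eventually
          (eventually_ge_atTop N)
    have hchoice : ∀ (k : ZMod (N + 1)) (n : ℕ), ∃ m, (k = 0 → m = n) ∧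
        (k ≠ 0 → m = φ (Nat.pair k.val n)) ∧ Nonempty (G n ≃ₗᵢ[ℂ] G m) := by
      intro k n
      by_cases hk : k = 0
      · exact ⟨n, fun _ => rfl, fun h => absurd hk h, ⟨LinearIsometryEquiv.refl ℂ _⟩⟩
      · obtain ⟨⟨w⟩, -⟩ := hφG (Nat.pair k.val n)
        rw [Nat.unpair_pair] at w
        exact ⟨_, fun h => absurd h hk, fun _ => rfl, ⟨w.symm⟩⟩
    choose τ hτ0 hτ1 w using hchoice
    have hge : ∀ k ≠ 0, ∀ n, N ≤ τ k n := fun k hk n => by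
      rw [hτ1 k n hk]
      exact (hφG _).2
    refine d.exists_matrixUnits (fun k n => (w k n).some) ?_ 0 fun n => hτ0 0 n rfl
    intro k l m hm n hn h
    by_cases hk : k = 0 <;> by_cases hl : l = 0
    · rw [hτ0 k m hk, hτ0 l n hl] at h
      exact ⟨hk.trans hl.symm, h⟩
    · have := hge l hl n
      rw [hτ0 k m hk] at h
      omega
    · have := hge k hk m
      rw [hτ0 l n hl] at h
      omega
    · rw [hτ1 k m hk, hτ1 l n hl] at h
      have := Nat.pair_eq_pair.1 (hφ.injective h)
      exact ⟨ZMod.val_injective _ this.1, this.2⟩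

end BlockDecomposition

/-! ### Universal properties of the projective and balanced tensor products. -/

section Lift

variable {E F H : Type*} [NormedAddCommGroup E] [NormedSpace ℂ E]
  [NormedAddCommGroup F] [NormedSpace ℂ F] [NormedAddCommGroup H] [NormedSpace ℂ H]

theorem AlgTensor.norm_tmul_le (x : E) (y : F) : ‖AlgTensor.tmul x y‖ ≤ ‖x‖ * ‖y‖ := by
  have h : AlgTensor.Represents [(x, y)] (AlgTensor.tmul x y) := add_zero (AlgTensor.tmul x y)
  exact (AlgTensor.projNorm_le h).trans_eq (by simp [AlgTensor.cost])

theorem AlgTensor.add_tmul (x x' : E) (y : F) :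
    AlgTensor.tmul (x + x') y = AlgTensor.tmul x y + AlgTensor.tmul x' y :=
  TensorProduct.add_tmul x x' y

theorem AlgTensor.tmul_add (x : E) (y y' : F) :
    AlgTensor.tmul x (y + y') = AlgTensor.tmul x y + AlgTensor.tmul x y' :=
  TensorProduct.tmul_add x y y'

theorem AlgTensor.smul_tmul (c : ℂ) (x : E) (y : F) :
    AlgTensor.tmul (c • x) y = c • AlgTensor.tmul x y :=
  (TensorProduct.smul_tmul' c x y).symm

theorem AlgTensor.tmul_smul (c : ℂ) (x : E) (y : F) :
    AlgTensor.tmul x (c • y) = c • AlgTensor.tmul x y :=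
  TensorProduct.tmul_smul c x y

/-- The linearization of a bilinear map on the algebraic tensor product. -/
def AlgTensor.liftLinear (B : E →L[ℂ] F →L[ℂ] H) : AlgTensor E F →ₗ[ℂ] H :=
  (TensorProduct.lift ((ContinuousLinearMap.coeLM ℂ).comp (B : E →ₗ[ℂ] F →L[ℂ] H)) :
    E ⊗[ℂ] F →ₗ[ℂ] H)

theorem AlgTensor.liftLinear_tmul (B : E →L[ℂ] F →L[ℂ] H) (x : E) (y : F) :
    AlgTensor.liftLinear B (AlgTensor.tmul x y) = B x y :=
  TensorProduct.lift.tmul x y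

theorem AlgTensor.norm_liftLinear_le (B : E →L[ℂ] F →L[ℂ] H) (t : AlgTensor E F) :
    ‖AlgTensor.liftLinear B t‖ ≤ ‖B‖ * ‖t‖ := by
  change _ ≤ ‖B‖ * AlgTensor.projNorm t
  rw [AlgTensor.projNorm, Real.mul_iInf_of_nonneg (norm_nonneg B)]
  refine le_ciInf fun l => ?_
  have key : ∀ l : List (E × F), ‖AlgTensor.liftLinear B
      (l.map fun q => AlgTensor.tmul q.1 q.2).sum‖ ≤ ‖B‖ * AlgTensor.cost l := by
    intro l
    induction l with
    | nil => simp [AlgTensor.cost]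
    | cons q l ih =>
      rw [List.map_cons, List.sum_cons, map_add, AlgTensor.liftLinear_tmul]
      refine (norm_add_le _ _).trans ((add_le_add (B.le_opNorm₂ q.1 q.2) ih).trans_eq ?_)
      simp only [AlgTensor.cost, List.map_cons, List.sum_cons]
      ring
  obtain ⟨l, rfl⟩ := l
  exact key l

/-- The linearization of a bounded bilinear map on the projective tensor product. -/
def ProjTensor.lift [CompleteSpace H] (B : E →L[ℂ] F →L[ℂ] H) : ProjTensor E F →L[ℂ] H :=
  ((AlgTensor.liftLinear B).mkContinuous ‖B‖ (AlgTensor.norm_liftLinear_le B)).extend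
    (UniformSpace.Completion.toComplL (𝕜 := ℂ) (E := AlgTensor E F))

theorem ProjTensor.lift_tmul [CompleteSpace H] (B : E →L[ℂ] F →L[ℂ] H) (x : E) (y : F) :
    ProjTensor.lift B (ProjTensor.tmul x y) = B x y := by
  refine (ContinuousLinearMap.extend_eq _ (UniformSpace.Completion.denseRange_coe)
    (UniformSpace.Completion.isUniformInducing_coe _) _).trans ?_
  exact AlgTensor.liftLinear_tmul B x y

/-- The canonical bilinear map into the projective tensor product. -/
def ProjTensor.tmulL : E →L[ℂ] F →L[ℂ] ProjTensor E F :=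
  LinearMap.mkContinuous₂
    (LinearMap.mk₂ ℂ ProjTensor.tmul
      (fun x x' y => by
        rw [tmul, AlgTensor.add_tmul, UniformSpace.Completion.coe_add]; rfl)
      (fun c x y => by
        rw [tmul, AlgTensor.smul_tmul, UniformSpace.Completion.coe_smul]; rfl)
      (fun x y y' => by
        rw [tmul, AlgTensor.tmul_add, UniformSpace.Completion.coe_add]; rfl)
      (fun c x y => by
        rw [tmul, AlgTensor.tmul_smul, UniformSpace.Completion.coe_smul]; rfl)) 1 fun x y => by
    rw [one_mul]
    exact (UniformSpace.Completion.norm_coe _).trans_le (AlgTensor.norm_tmul_le x y)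

theorem ProjTensor.norm_tmul_le (x : E) (y : F) : ‖ProjTensor.tmul x y‖ ≤ ‖x‖ * ‖y‖ :=
  (UniformSpace.Completion.norm_coe _).trans_le (AlgTensor.norm_tmul_le x y)

/-- A closed subspace which contains the elementary tensors is everything. -/
theorem ProjTensor.mem_of_forall_tmul_mem {S : Submodule ℂ (ProjTensor E F)}
    (hS : IsClosed (S : Set (ProjTensor E F))) (h : ∀ x y, ProjTensor.tmul x y ∈ S)
    (z : ProjTensor E F) : z ∈ S := by
  refine UniformSpace.Completion.induction_on z hS fun t => ?_
  obtain ⟨l, rfl⟩ := AlgTensor.exists_represents t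
  induction l with
  | nil => exact S.zero_mem
  | cons q l ih =>
    rw [List.map_cons, List.sum_cons, UniformSpace.Completion.coe_add]
    exact S.add_mem (h _ _) ih

variable {A : Type*} (ρ : E → A → E) (σ : A → F → F)

instance isClosed_balancedRelations :
    IsClosed (balancedRelations ρ σ : Set (ProjTensor E F)) :=
  Submodule.isClosed_topologicalClosure _

/-- The canonical bilinear map into the balanced tensor product. -/
def BalancedTensor.tmulL : E →L[ℂ] F →L[ℂ] BalancedTensor ρ σ :=
  (ContinuousLinearMap.compL ℂ F (ProjTensor E F) (BalancedTensor ρ σ)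
    (balancedRelations ρ σ).mkQL).comp ProjTensor.tmulL

theorem BalancedTensor.tmulL_apply (x : E) (y : F) : BalancedTensor.tmulL ρ σ x y =
    (Submodule.Quotient.mk (ProjTensor.tmul x y) : BalancedTensor ρ σ) := rfl

theorem BalancedTensor.norm_tmulL_le (x : E) (y : F) :
    ‖BalancedTensor.tmulL ρ σ x y‖ ≤ ‖x‖ * ‖y‖ :=
  (Submodule.Quotient.norm_mk_le _ _).trans (ProjTensor.norm_tmul_le x y)

theorem BalancedTensor.tmulL_balanced (x : E) (a : A) (y : F) :
    BalancedTensor.tmulL ρ σ (ρ x a) y = BalancedTensor.tmulL ρ σ x (σ a y) := by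
  rw [tmulL_apply, tmulL_apply, Submodule.Quotient.eq]
  exact Submodule.le_topologicalClosure _ (Submodule.subset_span ⟨x, a, y, rfl⟩)

theorem BalancedTensor.mem_of_forall_tmulL_mem {S : Submodule ℂ (BalancedTensor ρ σ)}
    (hS : IsClosed (S : Set (BalancedTensor ρ σ)))
    (h : ∀ x y, BalancedTensor.tmulL ρ σ x y ∈ S) (z : BalancedTensor ρ σ) : z ∈ S := by
  obtain ⟨z, rfl⟩ := Submodule.Quotient.mk_surjective _ z
  exact ProjTensor.mem_of_forall_tmul_mem
    (S := S.comap ((balancedRelations ρ σ).mkQL : ProjTensor E F →ₗ[ℂ] BalancedTensor ρ σ))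
    (hS.preimage (balancedRelations ρ σ).mkQL.continuous) h z

/-- A balanced bounded bilinear map factors through the balanced tensor product. -/
theorem BalancedTensor.exists_lift [CompleteSpace H] (B : E →L[ℂ] F →L[ℂ] H)
    (hB : ∀ x a y, B (ρ x a) y = B x (σ a y)) :
    ∃ m : BalancedTensor ρ σ →L[ℂ] H, ∀ x y, m (BalancedTensor.tmulL ρ σ x y) = B x y := by
  have hker : balancedRelations ρ σ ≤ (ProjTensor.lift B).ker := by
    refine Submodule.topologicalClosure_minimal _ (Submodule.span_le.2 ?_)
      (ProjTensor.lift B).isClosed_ker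
    rintro _ ⟨x, a, y, rfl⟩
    simp [ProjTensor.lift_tmul, hB]
  exact ⟨(balancedRelations ρ σ).liftQL (ProjTensor.lift B) hker, ProjTensor.lift_tmul B⟩

end Lift

/-! ### From local factorization to the isomorphism with `𝒜(X)`. -/

section Factorization

variable {X Y Z : Type*} [NormedAddCommGroup X] [NormedSpace ℂ X]
  [NormedAddCommGroup Y] [NormedSpace ℂ Y] [NormedAddCommGroup Z] [NormedSpace ℂ Z]

instance completeSpace_approximable [CompleteSpace Y] : CompleteSpace (approximable X Y) :=
  (Submodule.isClosed_topologicalClosure (finiteRank X Y)).completeSpace_coe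

theorem dense_finiteRank :
    Dense {U : approximable X Y | (U : X →L[ℂ] Y) ∈ finiteRank X Y} := by
  rintro ⟨U, hU⟩
  rw [closure_subtype]
  refine closure_mono ?_ (show U ∈ closure (finiteRank X Y : Set (X →L[ℂ] Y)) from hU)
  exact fun T hT => ⟨⟨T, finiteRank_le_approximable hT⟩, hT, rfl⟩

/-- Composition of approximable operators as a bounded bilinear map. -/
def approximableCompL : approximable Y Z →L[ℂ] approximable X Y →L[ℂ] approximable X Z :=
  LinearMap.mkContinuous₂
    (LinearMap.mk₂ ℂ (fun (U : approximable Y Z) (V : approximable X Y) => approximableComp U V)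
      (fun U U' V => by ext x; rfl)
      (fun c U V => by ext x; rfl)
      (fun U V V' => by ext x; simp [approximableComp])
      (fun c U V => by ext x; simp [approximableComp])) 1 fun U V => by
    rw [one_mul]
    exact ContinuousLinearMap.opNorm_comp_le U.1 V.1

theorem approximableCompL_apply (U : approximable Y Z) (V : approximable X Y) :
    approximableCompL U V = approximableComp U V := rfl

/-- Composition on the left with a bounded operator. -/
def postcompApproximable (α : Y →L[ℂ] Z) (T : approximable X Y) : approximable X Z :=
  ⟨α.comp T.1, comp_mem_approximable α T.2⟩

theorem approximableCompL_balanced (U : approximable Y X) (S : approximable Y Y)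
    (V : approximable X Y) : approximableCompL (approximableComp U S) V =
      approximableCompL U (approximableComp S V) := by
  ext x
  rfl

/-- `m : Q → 𝒜(X)` linearizes composition, for a balanced bilinear map
`b : 𝒜(Y, X) × 𝒜(X, Y) → Q` of norm at most `1` whose values span a dense subspace. -/
structure LinearizesComp {Q : Type*} [NormedAddCommGroup Q] [NormedSpace ℂ Q]
    (b : approximable Y X →L[ℂ] approximable X Y →L[ℂ] Q) (m : Q →L[ℂ] approximable X X) :
    Prop where
  apply_eq : ∀ (U : approximable Y X) (V : approximable X Y), m (b U V) = approximableComp U V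
  balanced : ∀ (U : approximable Y X) (S : approximable Y Y) (V : approximable X Y),
    b (approximableComp U S) V = b U (approximableComp S V)
  norm_le : ∀ (U : approximable Y X) (V : approximable X Y), ‖b U V‖ ≤ ‖U‖ * ‖V‖
  mem_of_forall_mem : ∀ S : Submodule ℂ Q, IsClosed (S : Set Q) →
    (∀ (U : approximable Y X) (V : approximable X Y), b U V ∈ S) → ∀ z, z ∈ S

/-- The span of the values `b U V` with `U` of finite rank. -/
def finiteRankSpan {Q : Type*} [NormedAddCommGroup Q] [NormedSpace ℂ Q]
    (b : approximable Y X →L[ℂ] approximable X Y →L[ℂ] Q) : Submodule ℂ Q :=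
  Submodule.span ℂ {z | ∃ (U : approximable Y X) (V : approximable X Y),
    (U : Y →L[ℂ] X) ∈ finiteRank Y X ∧ b U V = z}

/-- The identities of the finite-dimensional subspaces of `X` factor uniformly
through `Y`, by approximable operators. -/
def FactorsLocally (X Y : Type*) [NormedAddCommGroup X] [NormedSpace ℂ X]
    [NormedAddCommGroup Y] [NormedSpace ℂ Y] (K : ℝ) : Prop :=
  ∀ E : Submodule ℂ X, FiniteDimensional ℂ E →
    ∃ (W : approximable Y X) (α : X →L[ℂ] Y) (b : ℝ), (∀ x ∈ E, W.1 (α x) = x) ∧ 0 ≤ b ∧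
      (∀ x ∈ E, ‖α x‖ ≤ b * ‖x‖) ∧ ‖W‖ * b ≤ K

namespace LinearizesComp

variable {Q : Type*} [NormedAddCommGroup Q] [NormedSpace ℂ Q]
  {b : approximable Y X →L[ℂ] approximable X Y →L[ℂ] Q} {m : Q →L[ℂ] approximable X X}

theorem mem_closure_finiteRankSpan (hm : LinearizesComp b m) (z : Q) :
    z ∈ (finiteRankSpan b).topologicalClosure := by
  refine hm.mem_of_forall_mem _ (Submodule.isClosed_topologicalClosure _) (fun U V => ?_) z
  have hcl : IsClosed {U | b U V ∈ (finiteRankSpan b).topologicalClosure} :=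
    (Submodule.isClosed_topologicalClosure (finiteRankSpan b)).preimage
      (f := fun U => b U V) (by fun_prop)
  refine closure_minimal (fun U hU => ?_) hcl (dense_finiteRank U)
  exact Submodule.le_topologicalClosure _ (Submodule.subset_span ⟨U, V, hU, rfl⟩)

/-- An element of `Q` is determined by its image in `𝒜(X)` as soon as the identity of a suitable
finite-dimensional subspace factors through `Y`. -/
theorem exists_eq_postcomp (hm : LinearizesComp b m) {z : Q} (hz : z ∈ finiteRankSpan b) :
    ∃ E : Submodule ℂ X, FiniteDimensional ℂ E ∧ (∀ x, (m z).1 x ∈ E) ∧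
      ∀ (W : approximable Y X) (α : X →L[ℂ] Y), (∀ x ∈ E, W.1 (α x) = x) →
        z = b W (postcompApproximable α (m z)) := by
  induction hz using Submodule.span_induction with
  | mem z hz =>
    obtain ⟨U, V, hU, rfl⟩ := hz
    refine ⟨LinearMap.range (U.1 : Y →ₗ[ℂ] X), hU, fun x => ?_, fun W α h => ?_⟩
    · rw [hm.apply_eq]
      exact ⟨V.1 x, rfl⟩
    -- `W ∘ α` fixes the range of `U`, and `α ∘ U` is approximable on `Y`, so balancing carries it
    -- across the tensor.
    · have hWU : U = approximableComp W (postcompApproximable α U) :=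
        Subtype.ext (ContinuousLinearMap.ext fun y => (h _ ⟨y, rfl⟩).symm)
      rw [hm.apply_eq]
      conv_lhs => rw [hWU]
      exact hm.balanced W (postcompApproximable α U) V
  | zero =>
    refine ⟨⊥, inferInstance, fun x => by simp, fun W α _ => ?_⟩
    have : postcompApproximable α (m 0) = 0 := by
      rw [map_zero]
      exact Subtype.ext (ContinuousLinearMap.comp_zero α)
    rw [this, map_zero]
  | add z₁ z₂ _ _ h₁ h₂ =>
    obtain ⟨E₁, hE₁, hr₁, h₁⟩ := h₁
    obtain ⟨E₂, hE₂, hr₂, h₂⟩ := h₂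
    -- A pair `W, α` that works on the sum of the subspaces works for both summands, so the sum is
    -- again a single tensor with first factor `W`.
    refine ⟨E₁ ⊔ E₂, inferInstance, fun x => ?_, fun W α h => ?_⟩
    · rw [map_add]
      exact Submodule.add_mem_sup (hr₁ x) (hr₂ x)
    · have : postcompApproximable α (m (z₁ + z₂)) =
          postcompApproximable α (m z₁) + postcompApproximable α (m z₂) := by
        rw [map_add]
        exact Subtype.ext (ContinuousLinearMap.comp_add α _ _)
      rw [this, map_add, ← h₁ W α fun x hx => h x (Submodule.mem_sup_left hx),
        ← h₂ W α fun x hx => h x (Submodule.mem_sup_right hx)]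
  | smul c z _ h =>
    obtain ⟨E, hE, hr, h⟩ := h
    refine ⟨E, hE, fun x => ?_, fun W α hW => ?_⟩
    · rw [map_smul]
      exact E.smul_mem c (hr x)
    · have : postcompApproximable α (m (c • z)) = c • postcompApproximable α (m z) := by
        rw [map_smul]
        exact Subtype.ext (ContinuousLinearMap.comp_smul α c _)
      rw [this, map_smul, ← h W α hW]

/-- On the dense span, `z` is the single tensor of `W` and `α ∘ m z`, of norm at most `‖W‖ * ‖α ∘ m
z‖`. A bound for `α` on `E` alone is enough, because `m z` takes its values in `E`. -/
theorem norm_le_mul (hm : LinearizesComp b m) {K : ℝ} (h : FactorsLocally X Y K) (z : Q) :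
    ‖z‖ ≤ K * ‖m z‖ := by
  have hcl : IsClosed {z | ‖z‖ ≤ K * ‖m z‖} := isClosed_le continuous_norm (by fun_prop)
  refine closure_minimal (fun z hz => ?_) hcl (hm.mem_closure_finiteRankSpan z)
  obtain ⟨E, hE, hr, hfac⟩ := hm.exists_eq_postcomp hz
  obtain ⟨W, α, r, hW, hr0, hα, hK⟩ := h E hE
  have hn : ‖postcompApproximable α (m z)‖ ≤ r * ‖m z‖ := by
    refine ContinuousLinearMap.opNorm_le_bound _ (by positivity) fun x => ?_
    refine (hα _ (hr x)).trans ?_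
    rw [mul_assoc]
    gcongr
    exact (m z).1.le_opNorm x
  calc ‖z‖ = ‖b W (postcompApproximable α (m z))‖ := congrArg _ (hfac W α hW)
    _ ≤ ‖W‖ * ‖postcompApproximable α (m z)‖ := hm.norm_le _ _
    _ ≤ ‖W‖ * (r * ‖m z‖) := by gcongr
    _ = ‖W‖ * r * ‖m z‖ := by ring
    _ ≤ K * ‖m z‖ := by gcongr

/-- Being bounded below, `m` is injective with closed range. The range contains the finite rank
operators, since such a `T` equals `W ∘ (α ∘ T)`, and these are dense. -/
theorem exists_equiv [CompleteSpace X] [CompleteSpace Q] (hm : LinearizesComp b m) {K : ℝ}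
    (h : FactorsLocally X Y K) : ∃ e : Q ≃L[ℂ] approximable X X, ∀ z, e z = m z := by
  have hK : ∀ z, ‖z‖ ≤ (K.toNNReal : ℝ) * ‖m z‖ := fun z =>
    (hm.norm_le_mul h z).trans (by gcongr; exact Real.le_coe_toNNReal K)
  have hanti := AddMonoidHomClass.antilipschitz_of_bound m hK
  have hclosed : IsClosed (Set.range m) := hanti.isClosed_range m.uniformContinuous
  have hsurj : Function.Surjective m := by
    intro T
    refine closure_minimal (fun T hT => ?_) hclosed (dense_finiteRank T)
    obtain ⟨W, α, r, hW, -⟩ := h (LinearMap.range (T.1 : X →ₗ[ℂ] X)) hT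
    refine ⟨b W (postcompApproximable α T), ?_⟩
    rw [hm.apply_eq]
    exact Subtype.ext (ContinuousLinearMap.ext fun x => hW _ ⟨x, rfl⟩)
  let e₀ := LinearEquiv.ofBijective m.toLinearMap ⟨hanti.injective, hsurj⟩
  let e : Q ≃L[ℂ] approximable X X :=
    { e₀ with
      continuous_toFun := m.continuous
      continuous_invFun := (hanti.to_rightInverse e₀.right_inv).continuous }
  exact ⟨e, fun _ => rfl⟩

end LinearizesComp

theorem FactorsLocally.factorsApproximately [CompleteSpace X] {K : ℝ}
    (h : FactorsLocally X Y K) : FactorsApproximately X Y := by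
  let ρ := fun (U : approximable Y X) (S : approximable Y Y) => approximableComp U S
  let σ := fun (S : approximable Y Y) (V : approximable X Y) => approximableComp S V
  let b := BalancedTensor.tmulL ρ σ
  obtain ⟨m, hmb⟩ := BalancedTensor.exists_lift (H := approximable X X) ρ σ approximableCompL
    approximableCompL_balanced
  have hm : LinearizesComp b m :=
    { apply_eq := fun U V => (hmb U V).trans (approximableCompL_apply U V)
      balanced := BalancedTensor.tmulL_balanced ρ σ
      norm_le := BalancedTensor.norm_tmulL_le ρ σ
      mem_of_forall_mem := fun _ => BalancedTensor.mem_of_forall_tmulL_mem ρ σ }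
  obtain ⟨e, he⟩ := hm.exists_equiv h
  exact ⟨e, fun U V => (he _).trans (hm.apply_eq U V)⟩

end Factorization

/-! ### Local factorization of a `J`-space through one block. -/

theorem IsJSpace.exists_factorsLocally {G : ℕ → Type*} [∀ n, NormedAddCommGroup (G n)]
    [∀ n, NormedSpace ℂ (G n)] [∀ n, FiniteDimensional ℂ (G n)]
    {J X : Type*} [NormedAddCommGroup J] [NormedSpace ℂ J] (d : BlockDecomposition G J)
    [NormedAddCommGroup X] [NormedSpace ℂ X] (hX : IsJSpace G X) : ∃ K, FactorsLocally X J K := by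
  obtain ⟨C, hC, hX⟩ := hX
  -- The Banach–Mazur distance is an infimum that need not be attained. The slack `1` yields an
  -- actual isomorphism `T`.
  refine ⟨C + 1, fun E hE => ?_⟩
  obtain ⟨H, hEH, i, hi⟩ := hX E hE
  have hlt : banachMazurDist H (G i) < ENNReal.ofReal (C + 1) :=
    hi.trans_lt ((ENNReal.ofReal_lt_ofReal_iff (by linarith)).2 (by linarith))
  obtain ⟨T, hT⟩ := iInf_lt_iff.1 hlt
  have hTC := ((ENNReal.ofReal_lt_ofReal_iff (by linarith)).1 hT).le
  have : FiniteDimensional ℂ H := T.symm.toLinearEquiv.finiteDimensional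
  -- The norm of this projection onto `H` is not controlled uniformly. It does not matter, as `p` is
  -- the identity on `E` and `α` is only estimated there.
  obtain ⟨p, hp⟩ := Submodule.ClosedComplemented.of_finiteDimensional H
  refine ⟨⟨(H.subtypeL.comp (T.symm : G i →L[ℂ] H)).comp (d.proj i),
    finiteRank_le_approximable (comp_mem_finiteRank _ _)⟩,
    (d.incl i).comp ((T : H →L[ℂ] G i).comp p), ‖(T : H →L[ℂ] G i)‖, fun x hx => ?_,
    norm_nonneg _, fun x hx => ?_, ?_⟩
  · have := hp ⟨x, hEH hx⟩
    simp [d.proj_incl_same, this]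
  · have := hp ⟨x, hEH hx⟩
    change ‖d.incl i (T (p x))‖ ≤ _
    rw [d.norm_incl, this]
    exact (T : H →L[ℂ] G i).le_opNorm ⟨x, hEH hx⟩
  · refine le_trans ?_ hTC
    rw [mul_comm]
    gcongr
    refine ContinuousLinearMap.opNorm_le_bound _ (norm_nonneg _) fun x => ?_
    refine ((T.symm : G i →L[ℂ] H).le_opNorm (d.proj i x)).trans ?_
    gcongr
    exact d.norm_proj_apply_le i x

end BanachOp

end

theorem proposition4p6 (G : ℕ → Type*) [∀ n, NormedAddCommGroup (G n)]
    [∀ n, NormedSpace ℂ (G n)]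
    (J : Type*) [NormedAddCommGroup J] [NormedSpace ℂ J] [CompleteSpace J]
    (hJ : BanachOp.IsJohnsonSpace G J)
    (X : Type*) [NormedAddCommGroup X] [NormedSpace ℂ X] [CompleteSpace X]
    (hX : BanachOp.IsJSpace G X) :
    BanachOp.WeaklyAmenable (BanachOp.approximableAlgebra J) ∧
      BanachOp.FactorsApproximately X J := by
  have := hJ.finiteDimensional
  obtain ⟨d⟩ := hJ.nonempty_blockDecomposition
  obtain ⟨K, hK⟩ := hX.exists_factorsLocally d
  exact ⟨d.weaklyAmenable hJ.infinite_isometric, hK.factorsApproximately⟩
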